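/- Let $H$ be a finite-dimensional Hopf algebra over an arbitrary field $k$, with comultiplication $\Delta$, counit $\varepsilon$ and antipode $S$, and let $R\subseteq H$ be a Hopf subalgebra (a unital subalgebra with $\Delta(R)\subseteq R\otimes R$ and $S(R)\subseteq R$). Put $R^+=\ker(\varepsilon|_R)$ and let $V=H/R^+H$, a right $H$-module and, by restriction, a right $R$-module. For modules write $M\sim N$ (similar) if $M\oplus P\cong N^{q}$ and $N\oplus P'\cong M^{r}$ for some $q,r\in\mathbb N$ and some modules $P,P'$. Let $H^{\otimes_R n}$ be the $n$-fold tensor power of $H$ over $R$ for $n\ge 1$, and $H^{\otimes_R 0}=R$ (an $R$-$R$-bimodule). The extension $R\subseteq H$ has depth $2n+1$ ($n\ge 0$) if $H^{\otimes_R(n+1)}\sim H^{\otimes_R n}$ as $R$-$R$-bimodules, and depth $2n$ ($n\ge 1$) if $H^{\otimes_R(n+1)}\sim H^{\otimes_R n}$ as $R$-$H$-bimodules or as $H$-$R$-bimodules. The minimum depth $d(R,H)\in\mathbb N\cup\{\infty\}$ is the least depth of $R\subseteq H$, and $\infty$ if there is none. A Hopf algebra has finite representation type if it has only finitely many isomorphism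 classes of finite-dimensional indecomposable right modules. It has the Chevalley property if the tensor product over $k$ of any two simple right modules, with the diagonal action, is semisimple. Then $d(R,H)<\infty$ if any one of the following conditions holds: 1. $R$ or $H$ has finite representation type; 2. $V$ is projective as a right $R$-module or as a right $H$-module; 3. $V$ is semisimple as a right $R$-module and $R$ has the Chevalley property. Moreover, $R$ has the Chevalley property if the dual Hopf algebra $R^*$ is pointed, i.e. if every simple subcoalgebra of $R^*$ is one-dimensional. -/

import Mathlib

open scoped TensorProduct

universe u v w

noncomputable section

namespace HopfDepth

/-! ### Modules: direct summands of multiples, similarity, representation type -/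

section Modules

/-- `M` divides a multiple of `N`: `M ⊕ P ≅ N ⊕ ⋯ ⊕ N` (`q` times) for some `q` and some `P`. -/
def DividesMultiple (S : Type v) [Ring S] (M N : Type u) [AddCommGroup M] [Module S M]
    [AddCommGroup N] [Module S N] : Prop :=
  ∃ (q : ℕ) (P : Type u) (_ : AddCommGroup P) (_ : Module S P),
    Nonempty ((M × P) ≃ₗ[S] (Fin q → N))

/-- Two modules are similar if each divides a multiple of the other. -/
def Similar (S : Type v) [Ring S] (M N : Type u) [AddCommGroup M] [Module S M]
    [AddCommGroup N] [Module S N] : Prop :=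
  DividesMultiple S M N ∧ DividesMultiple S N M

/-- A nonzero module that is not the internal direct sum of two nonzero submodules. -/
def IsIndecomposable (S : Type v) [Ring S] (M : Type u) [AddCommGroup M] [Module S M] : Prop :=
  Nontrivial M ∧ ∀ N P : Submodule S M, IsCompl N P → N = ⊥ ∨ P = ⊥

/-- Finite representation type: there are, up to isomorphism, only finitely many finitely generated
indecomposable right `A`-modules. (For a finite-dimensional algebra, finitely generated means
finite-dimensional.) -/
def FiniteRepresentationType (A : Type u) [Ring A] : Prop :=
  ∃ (t : ℕ) (F : Fin t → ModuleCat.{u} Aᵐᵒᵖ),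
    ∀ (M : Type u) [AddCommGroup M] [Module Aᵐᵒᵖ M] [Module.Finite Aᵐᵒᵖ M],
      IsIndecomposable Aᵐᵒᵖ M → ∃ i, Nonempty (M ≃ₗ[Aᵐᵒᵖ] F i)

end Modules

/-! ### Bimodules and their tensor products -/

/-- An `A`-`B`-bimodule over `k`: commuting left `A`- and right `B`-module structures which induce
the same `k`-module structure. -/
structure KBimod (k : Type v) (A B : Type u) [Field k] [Ring A] [Algebra k A] [Ring B]
    [Algebra k B] where
  carrier : Type u
  [addCommGroup : AddCommGroup carrier]
  [moduleBase : Module k carrier]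
  [moduleLeft : Module A carrier]
  [moduleRight : Module Bᵐᵒᵖ carrier]
  [towerLeft : IsScalarTower k A carrier]
  [towerRight : IsScalarTower k Bᵐᵒᵖ carrier]
  [comm : SMulCommClass A Bᵐᵒᵖ carrier]

namespace KBimod

attribute [instance] addCommGroup moduleBase moduleLeft moduleRight towerLeft towerRight comm

variable {k : Type v} [Field k] {A B C D : Type u} [Ring A] [Algebra k A] [Ring B] [Algebra k B]
  [Ring C] [Algebra k C] [Ring D] [Algebra k D]

/-- An `A`-`B`-bimodule as a module over `A ⊗ Bᵒᵖ`, with `(a ⊗ b) • m = a m b`. -/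
instance moduleTensor (M : KBimod k A B) : Module (A ⊗[k] Bᵐᵒᵖ) M.carrier :=
  TensorProduct.Algebra.module

/-- Similarity of bimodules. -/
def Similar (M N : KBimod k A B) : Prop :=
  HopfDepth.Similar (A ⊗[k] Bᵐᵒᵖ) M.carrier N.carrier

/-- The algebra `A` as an `A`-`A`-bimodule. -/
def regular (k : Type v) [Field k] (A : Type u) [Ring A] [Algebra k A] : KBimod k A A where
  carrier := A

/-- Restriction of a bimodule along algebra homomorphisms on both sides. -/
def restrict (f : C →ₐ[k] A) (g : D →ₐ[k] B) (M : KBimod k A B) : KBimod k C D :=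
  letI : Module C M.carrier := Module.compHom M.carrier f.toRingHom
  letI : Module Dᵐᵒᵖ M.carrier := Module.compHom M.carrier (AlgHom.op g).toRingHom
  { carrier := M.carrier
    towerLeft := ⟨fun t c m => by
      change f (t • c) • m = t • (f c • m)
      rw [map_smul, smul_assoc]⟩
    towerRight := ⟨fun t d m => by
      change AlgHom.op g (t • d) • m = t • (AlgHom.op g d • m)
      rw [map_smul, smul_assoc]⟩
    comm := ⟨fun c d m => by
      change f c • (AlgHom.op g d • m) = AlgHom.op g d • (f c • m)
      rw [smul_comm]⟩ }

/-- The relations `m b ⊗ n = m ⊗ b n`. -/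
def balancingRelations (M : KBimod k A B) (N : KBimod k B C) :
    Submodule k (M.carrier ⊗[k] N.carrier) :=
  Submodule.span k {x | ∃ (m : M.carrier) (b : B) (n : N.carrier),
    x = (MulOpposite.op b • m) ⊗ₜ[k] n - m ⊗ₜ[k] (b • n)}

/-- The underlying `k`-module of `M ⊗_B N`. -/
def TensorCarrier (M : KBimod k A B) (N : KBimod k B C) : Type u :=
  (M.carrier ⊗[k] N.carrier) ⧸ balancingRelations M N

instance (M : KBimod k A B) (N : KBimod k B C) : AddCommGroup (TensorCarrier M N) :=
  inferInstanceAs (AddCommGroup ((M.carrier ⊗[k] N.carrier) ⧸ balancingRelations M N))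

instance (M : KBimod k A B) (N : KBimod k B C) : Module k (TensorCarrier M N) :=
  inferInstanceAs (Module k ((M.carrier ⊗[k] N.carrier) ⧸ balancingRelations M N))

/-- The class of `m ⊗ n` in `M ⊗_B N`. -/
def tmul (M : KBimod k A B) (N : KBimod k B C) (m : M.carrier) (n : N.carrier) :
    TensorCarrier M N :=
  (balancingRelations M N).mkQ (m ⊗ₜ[k] n)

theorem linearMap_ext {M : KBimod k A B} {N : KBimod k B C}
    {f g : Module.End k (TensorCarrier M N)}
    (h : ∀ m n, f (tmul M N m n) = g (tmul M N m n)) : f = g :=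
  Submodule.linearMap_qext _ (TensorProduct.ext' h)

/-- The endomorphism `m ⊗ n ↦ φ m ⊗ ψ n` of `M ⊗_B N`, for `φ` and `ψ` commuting with `B`. -/
def mapEnd (M : KBimod k A B) (N : KBimod k B C) (φ : Module.End k M.carrier)
    (ψ : Module.End k N.carrier)
    (hφ : ∀ (b : B) m, φ (MulOpposite.op b • m) = MulOpposite.op b • φ m)
    (hψ : ∀ (b : B) n, ψ (b • n) = b • ψ n) : Module.End k (TensorCarrier M N) :=
  (balancingRelations M N).mapQ (balancingRelations M N) (TensorProduct.map φ ψ) (by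
    rw [balancingRelations, Submodule.span_le]
    rintro _ ⟨m, b, n, rfl⟩
    refine Submodule.subset_span ⟨φ m, b, ψ n, ?_⟩
    simp [hφ, hψ])

theorem mapEnd_tmul (M : KBimod k A B) (N : KBimod k B C) (φ : Module.End k M.carrier)
    (ψ : Module.End k N.carrier) (hφ hψ) (m : M.carrier) (n : N.carrier) :
    mapEnd M N φ ψ hφ hψ (tmul M N m n) = tmul M N (φ m) (ψ n) := rfl

theorem add_tmul (M : KBimod k A B) (N : KBimod k B C) (m m' : M.carrier) (n : N.carrier) :
    tmul M N (m + m') n = tmul M N m n + tmul M N m' n :=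
  congrArg (balancingRelations M N).mkQ (TensorProduct.add_tmul m m' n)

theorem tmul_add (M : KBimod k A B) (N : KBimod k B C) (m : M.carrier) (n n' : N.carrier) :
    tmul M N m (n + n') = tmul M N m n + tmul M N m n' :=
  congrArg (balancingRelations M N).mkQ (TensorProduct.tmul_add m n n')

theorem smul_tmul (M : KBimod k A B) (N : KBimod k B C) (t : k) (m : M.carrier) (n : N.carrier) :
    tmul M N (t • m) n = t • tmul M N m n := rfl

theorem tmul_smul (M : KBimod k A B) (N : KBimod k B C) (t : k) (m : M.carrier) (n : N.carrier) :
    tmul M N m (t • n) = t • tmul M N m n :=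
  congrArg (balancingRelations M N).mkQ (TensorProduct.tmul_smul t m n)

/-- The left action `a (m ⊗ n) = a m ⊗ n` of `A` on `M ⊗_B N`. -/
def leftAction (M : KBimod k A B) (N : KBimod k B C) : A →ₐ[k] Module.End k (TensorCarrier M N) :=
  AlgHom.ofLinearMap
    { toFun := fun a => mapEnd M N (Algebra.lsmul k k M.carrier a) LinearMap.id
        (fun b m => by simpa using smul_comm a (MulOpposite.op b) m) (fun _ _ => rfl)
      map_add' := fun a a' => linearMap_ext fun m n => by
        simp only [mapEnd_tmul, map_add, LinearMap.add_apply, add_tmul]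
      map_smul' := fun t a => linearMap_ext fun m n => by
        simp only [mapEnd_tmul, map_smul, LinearMap.smul_apply, smul_tmul, RingHom.id_apply] }
    (linearMap_ext fun m n => by simp [mapEnd_tmul])
    (fun a a' => linearMap_ext fun m n => by simp [mapEnd_tmul])

/-- The right action `(m ⊗ n) c = m ⊗ n c` of `C` on `M ⊗_B N`. -/
def rightAction (M : KBimod k A B) (N : KBimod k B C) :
    Cᵐᵒᵖ →ₐ[k] Module.End k (TensorCarrier M N) :=
  AlgHom.ofLinearMap
    { toFun := fun c => mapEnd M N LinearMap.id (Algebra.lsmul k k N.carrier c)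
        (fun _ _ => rfl) (fun b n => by simpa using (smul_comm b c n).symm)
      map_add' := fun c c' => linearMap_ext fun m n => by
        simp only [mapEnd_tmul, map_add, LinearMap.add_apply, tmul_add]
      map_smul' := fun t c => linearMap_ext fun m n => by
        simp only [mapEnd_tmul, map_smul, LinearMap.smul_apply, tmul_smul, RingHom.id_apply] }
    (linearMap_ext fun m n => by simp [mapEnd_tmul])
    (fun c c' => linearMap_ext fun m n => by simp [mapEnd_tmul])

/-- The tensor product `M ⊗_B N` of an `A`-`B`-bimodule and a `B`-`C`-bimodule. -/
def tensor (M : KBimod k A B) (N : KBimod k B C) : KBimod k A C :=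
  letI : Module A (TensorCarrier M N) := Module.compHom _ (leftAction M N).toRingHom
  letI : Module Cᵐᵒᵖ (TensorCarrier M N) := Module.compHom _ (rightAction M N).toRingHom
  { carrier := TensorCarrier M N
    towerLeft := ⟨fun t a x => by
      change leftAction M N (t • a) x = t • leftAction M N a x
      rw [map_smul, LinearMap.smul_apply]⟩
    towerRight := ⟨fun t c x => by
      change rightAction M N (t • c) x = t • rightAction M N c x
      rw [map_smul, LinearMap.smul_apply]⟩
    comm := ⟨fun a c x => by
      have h : leftAction M N a * rightAction M N c = rightAction M N c * leftAction M N a :=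
        linearMap_ext fun m n => rfl
      exact LinearMap.congr_fun h x⟩ }

end KBimod

/-! ### Depth of a subalgebra -/

section Depth

variable {k : Type v} [Field k] {A : Type u} [Ring A] [Algebra k A]

/-- The `A`-`A`-bimodule `A ⊗_B ⋯ ⊗_B A` with `n + 1` factors. -/
def tensorPow (B : Subalgebra k A) : ℕ → KBimod k A A
  | 0 => KBimod.regular k A
  | n + 1 => ((tensorPow B n).restrict (AlgHom.id k A) B.val).tensor
      ((KBimod.regular k A).restrict B.val (AlgHom.id k A))

/-- The `B`-`B`-bimodule `A ⊗_B ⋯ ⊗_B A` with `n` factors; it is `B` for `n = 0`. -/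
def tensorPowSub (B : Subalgebra k A) : ℕ → KBimod k B B
  | 0 => KBimod.regular k B
  | n + 1 => (tensorPow B n).restrict B.val B.val

/-- `B ⊆ A` has depth `2 n + 1`: the tensor powers of `A` over `B` with `n + 1` and `n` factors are
similar as `B`-`B`-bimodules. -/
def HasOddDepth (B : Subalgebra k A) (n : ℕ) : Prop :=
  (tensorPowSub B (n + 1)).Similar (tensorPowSub B n)

/-- `B ⊆ A` has left depth `2 (n + 1)`: the tensor powers of `A` over `B` with `n + 2` and `n + 1`
factors are similar as `B`-`A`-bimodules. -/
def HasLeftDepth (B : Subalgebra k A) (n : ℕ) : Prop :=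
  ((tensorPow B (n + 1)).restrict B.val (AlgHom.id k A)).Similar
    ((tensorPow B n).restrict B.val (AlgHom.id k A))

/-- `B ⊆ A` has right depth `2 (n + 1)`: the tensor powers of `A` over `B` with `n + 2` and `n + 1`
factors are similar as `A`-`B`-bimodules. -/
def HasRightDepth (B : Subalgebra k A) (n : ℕ) : Prop :=
  ((tensorPow B (n + 1)).restrict (AlgHom.id k A) B.val).Similar
    ((tensorPow B n).restrict (AlgHom.id k A) B.val)

/-- `B ⊆ A` has depth `d`; for even `d` this means left or right depth `d`. -/
def HasDepth (B : Subalgebra k A) (d : ℕ) : Prop :=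
  (∃ n, d = 2 * n + 1 ∧ HasOddDepth B n) ∨
    (∃ n, d = 2 * (n + 1) ∧ (HasLeftDepth B n ∨ HasRightDepth B n))

/-- The minimum depth `d(B, A)`, which is `⊤` if there is no finite depth. -/
def minDepth (B : Subalgebra k A) : ℕ∞ :=
  sInf {d : ℕ∞ | ∃ m : ℕ, d = m ∧ HasDepth B m}

end Depth

/-! ### Hopf subalgebras -/

/-- A Hopf subalgebra: a subalgebra `R` with `Δ(R) ⊆ R ⊗ R` and `S(R) ⊆ R`. -/
structure HopfSubalgebra (k : Type v) (H : Type u) [Field k] [Ring H] [HopfAlgebra k H] extends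
    Subalgebra k H where
  comul_mem' : ∀ x ∈ toSubalgebra, Coalgebra.comul (R := k) x ∈
    (Algebra.TensorProduct.map toSubalgebra.val toSubalgebra.val).range
  antipode_mem' : ∀ x ∈ toSubalgebra, HopfAlgebra.antipode k x ∈ toSubalgebra

namespace HopfSubalgebra

variable {k : Type v} {H : Type u} [Field k] [Ring H] [HopfAlgebra k H] (R : HopfSubalgebra k H)

/-- The underlying algebra of a Hopf subalgebra. -/
abbrev Carrier : Type u := R.toSubalgebra

/-- The inclusion `R ⊗ R → H ⊗ H`. -/
abbrev inclTensor : R.Carrier ⊗[k] R.Carrier →ₐ[k] H ⊗[k] H :=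
  Algebra.TensorProduct.map R.toSubalgebra.val R.toSubalgebra.val

theorem inclTensor_injective : Function.Injective R.inclTensor :=
  TensorProduct.map_injective_of_flat_flat R.toSubalgebra.val.toLinearMap
    R.toSubalgebra.val.toLinearMap Subtype.val_injective Subtype.val_injective

/-- The comultiplication of `H` restricted to `R → R ⊗ R`. -/
def comulRestrict : R.Carrier →ₐ[k] R.Carrier ⊗[k] R.Carrier :=
  (AlgEquiv.ofInjective R.inclTensor R.inclTensor_injective).symm.toAlgHom.comp
    (((Bialgebra.comulAlgHom k H).comp R.toSubalgebra.val).codRestrict R.inclTensor.range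
      fun x => R.comul_mem' x x.2)

theorem inclTensor_comulRestrict (x : R.Carrier) :
    R.inclTensor (R.comulRestrict x) = Coalgebra.comul (R := k) (x : H) :=
  congrArg Subtype.val ((AlgEquiv.ofInjective R.inclTensor R.inclTensor_injective).apply_symm_apply
    ⟨Coalgebra.comul (R := k) (x : H), R.comul_mem' x x.2⟩)

theorem inclTensor_comp_comulRestrict :
    R.inclTensor.comp R.comulRestrict = (Bialgebra.comulAlgHom k H).comp R.toSubalgebra.val :=
  AlgHom.ext R.inclTensor_comulRestrict

/-- The inclusion `R ⊗ (R ⊗ R) → H ⊗ (H ⊗ H)` is injective. -/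
theorem inclTensor₃_injective :
    Function.Injective (Algebra.TensorProduct.map R.toSubalgebra.val R.inclTensor) :=
  TensorProduct.map_injective_of_flat_flat R.toSubalgebra.val.toLinearMap
    R.inclTensor.toLinearMap Subtype.val_injective R.inclTensor_injective

theorem incl_assoc (z : (R.Carrier ⊗[k] R.Carrier) ⊗[k] R.Carrier) :
    Algebra.TensorProduct.map R.toSubalgebra.val R.inclTensor
        (Algebra.TensorProduct.assoc k k k R.Carrier R.Carrier R.Carrier z) =
      Algebra.TensorProduct.assoc k k k H H H
        (Algebra.TensorProduct.map R.inclTensor R.toSubalgebra.val z) := by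
  induction z with
  | zero => simp only [map_zero]
  | add a b ha hb => simp only [map_add, ha, hb]
  | tmul a c =>
    induction a with
    | zero => simp only [TensorProduct.zero_tmul, map_zero]
    | add a b ha hb => simp only [TensorProduct.add_tmul, map_add, ha, hb]
    | tmul a b => rfl

theorem incl_comul_left (y : R.Carrier ⊗[k] R.Carrier) :
    Algebra.TensorProduct.map R.inclTensor R.toSubalgebra.val
        (Algebra.TensorProduct.map R.comulRestrict (.id k R.Carrier) y) =
      Algebra.TensorProduct.map (Bialgebra.comulAlgHom k H) (.id k H) (R.inclTensor y) := by
  induction y with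
  | zero => simp only [map_zero]
  | add a b ha hb => simp only [map_add, ha, hb]
  | tmul a b =>
    simp only [Algebra.TensorProduct.map_tmul, inclTensor_comulRestrict]
    rfl

theorem incl_comul_right (y : R.Carrier ⊗[k] R.Carrier) :
    Algebra.TensorProduct.map R.toSubalgebra.val R.inclTensor
        (Algebra.TensorProduct.map (.id k R.Carrier) R.comulRestrict y) =
      Algebra.TensorProduct.map (.id k H) (Bialgebra.comulAlgHom k H) (R.inclTensor y) := by
  induction y with
  | zero => simp only [map_zero]
  | add a b ha hb => simp only [map_add, ha, hb]
  | tmul a b =>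
    simp only [Algebra.TensorProduct.map_tmul, inclTensor_comulRestrict]
    rfl

theorem incl_counit_left (y : R.Carrier ⊗[k] R.Carrier) :
    Algebra.TensorProduct.map (.id k k) R.toSubalgebra.val (Algebra.TensorProduct.map
        ((Bialgebra.counitAlgHom k H).comp R.toSubalgebra.val) (.id k R.Carrier) y) =
      Algebra.TensorProduct.map (Bialgebra.counitAlgHom k H) (.id k H) (R.inclTensor y) := by
  induction y with
  | zero => simp only [map_zero]
  | add a b ha hb => simp only [map_add, ha, hb]
  | tmul a b => rfl

theorem incl_counit_right (y : R.Carrier ⊗[k] R.Carrier) :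
    Algebra.TensorProduct.map R.toSubalgebra.val (.id k k) (Algebra.TensorProduct.map
        (.id k R.Carrier) ((Bialgebra.counitAlgHom k H).comp R.toSubalgebra.val) y) =
      Algebra.TensorProduct.map (.id k H) (Bialgebra.counitAlgHom k H) (R.inclTensor y) := by
  induction y with
  | zero => simp only [map_zero]
  | add a b ha hb => simp only [map_add, ha, hb]
  | tmul a b => rfl

/-- The bialgebra structure of a Hopf subalgebra, restricted from `H`. -/
instance bialgebra : Bialgebra k R.Carrier :=
  Bialgebra.ofAlgHom R.comulRestrict ((Bialgebra.counitAlgHom k H).comp R.toSubalgebra.val)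
    (AlgHom.ext fun x => R.inclTensor₃_injective <| by
      have h := Coalgebra.coassoc_apply (R := k) (x : H)
      refine (R.incl_assoc _).trans ?_
      refine Eq.trans ?_ (R.incl_comul_right (R.comulRestrict x)).symm
      refine (congrArg _ (R.incl_comul_left (R.comulRestrict x))).trans ?_
      rw [inclTensor_comulRestrict]
      exact h)
    (AlgHom.ext fun x => by
      have hinj : Function.Injective
          (Algebra.TensorProduct.map (.id k k) R.toSubalgebra.val) :=
        TensorProduct.map_injective_of_flat_flat LinearMap.id
          R.toSubalgebra.val.toLinearMap Function.injective_id Subtype.val_injective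
      apply hinj
      refine (R.incl_counit_left (R.comulRestrict x)).trans ?_
      rw [inclTensor_comulRestrict]
      exact Coalgebra.rTensor_counit_comul (R := k) (x : H))
    (AlgHom.ext fun x => by
      have hinj : Function.Injective
          (Algebra.TensorProduct.map R.toSubalgebra.val (.id k k)) :=
        TensorProduct.map_injective_of_flat_flat R.toSubalgebra.val.toLinearMap
          LinearMap.id Subtype.val_injective Function.injective_id
      apply hinj
      refine (R.incl_counit_right (R.comulRestrict x)).trans ?_
      rw [inclTensor_comulRestrict]
      exact Coalgebra.lTensor_counit_comul (R := k) (x : H))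

theorem coe_counit (x : R.Carrier) :
    Coalgebra.counit (R := k) x = Coalgebra.counit (R := k) (x : H) := rfl

theorem inclTensor_comul (x : R.Carrier) :
    R.inclTensor (Coalgebra.comul (R := k) x) = Coalgebra.comul (R := k) (x : H) :=
  R.inclTensor_comulRestrict x

/-- The antipode of `H` restricted to `R → R`. -/
def antipodeRestrict : R.Carrier →ₗ[k] R.Carrier :=
  LinearMap.codRestrict (Subalgebra.toSubmodule R.toSubalgebra)
    (HopfAlgebra.antipode k (A := H) ∘ₗ R.toSubalgebra.val.toLinearMap)
    fun x => R.antipode_mem' x x.2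

theorem coe_mul_antipode_left (y : R.Carrier ⊗[k] R.Carrier) :
    (LinearMap.mul' k R.Carrier (R.antipodeRestrict.rTensor R.Carrier y) : H) =
      LinearMap.mul' k H ((HopfAlgebra.antipode k (A := H)).rTensor H (R.inclTensor y)) := by
  induction y with
  | zero => simp only [map_zero, ZeroMemClass.coe_zero]
  | add a b ha hb => simp only [map_add, ← ha, ← hb, AddMemClass.coe_add]
  | tmul a b => rfl

theorem coe_mul_antipode_right (y : R.Carrier ⊗[k] R.Carrier) :
    (LinearMap.mul' k R.Carrier (R.antipodeRestrict.lTensor R.Carrier y) : H) =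
      LinearMap.mul' k H ((HopfAlgebra.antipode k (A := H)).lTensor H (R.inclTensor y)) := by
  induction y with
  | zero => simp only [map_zero, ZeroMemClass.coe_zero]
  | add a b ha hb => simp only [map_add, ← ha, ← hb, AddMemClass.coe_add]
  | tmul a b => rfl

/-- The Hopf algebra structure of a Hopf subalgebra, restricted from `H`. -/
instance hopfAlgebra : HopfAlgebra k R.Carrier where
  antipode := R.antipodeRestrict
  mul_antipode_rTensor_comul := LinearMap.ext fun x => Subtype.ext <| by
    refine (R.coe_mul_antipode_left (R.comulRestrict x)).trans ?_
    rw [inclTensor_comulRestrict]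
    exact HopfAlgebra.mul_antipode_rTensor_comul_apply (R := k) (x : H)
  mul_antipode_lTensor_comul := LinearMap.ext fun x => Subtype.ext <| by
    refine (R.coe_mul_antipode_right (R.comulRestrict x)).trans ?_
    rw [inclTensor_comulRestrict]
    exact HopfAlgebra.mul_antipode_lTensor_comul_apply (R := k) (x : H)

/-- The right ideal `R⁺ H` of `H`, where `R⁺` is the kernel of the counit of `R`. -/
def augIdeal : Submodule Hᵐᵒᵖ H :=
  Submodule.span Hᵐᵒᵖ {x | x ∈ R.toSubalgebra ∧ Coalgebra.counit (R := k) x = 0}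

/-- The generalized permutation module `V = H / R⁺ H`, a right `H`-module. -/
def PermModule : Type u := H ⧸ R.augIdeal

instance : AddCommGroup R.PermModule := inferInstanceAs (AddCommGroup (H ⧸ R.augIdeal))

instance : Module Hᵐᵒᵖ R.PermModule := inferInstanceAs (Module Hᵐᵒᵖ (H ⧸ R.augIdeal))

/-- `V` as a right `R`-module, by restriction. -/
instance : Module R.Carrierᵐᵒᵖ R.PermModule :=
  Module.compHom R.PermModule (AlgHom.op R.toSubalgebra.val).toRingHom

end HopfSubalgebra

/-! ### Tensor products of right modules and the Chevalley property -/

section Chevalley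

variable (k : Type v) [Field k] (A : Type u) [Ring A] [Bialgebra k A]

/-- The tensor product `M ⊗ N` over `k` of two right modules over a bialgebra `A`. -/
def RightTensor (M N : Type u) [AddCommGroup M] [Module k M] [AddCommGroup N] [Module k N] :
    Type u := M ⊗[k] N

variable (M N : Type u) [AddCommGroup M] [Module k M] [Module Aᵐᵒᵖ M] [IsScalarTower k Aᵐᵒᵖ M]
  [AddCommGroup N] [Module k N] [Module Aᵐᵒᵖ N] [IsScalarTower k Aᵐᵒᵖ N]

instance : AddCommGroup (RightTensor k M N) := inferInstanceAs (AddCommGroup (M ⊗[k] N))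

instance : Module k (RightTensor k M N) := inferInstanceAs (Module k (M ⊗[k] N))

/-- The diagonal action `(m ⊗ n) a = ∑ m a₍₁₎ ⊗ n a₍₂₎`. -/
def diagonalAction : Aᵐᵒᵖ →ₐ[k] Module.End k (M ⊗[k] N) :=
  ((Module.endTensorEndAlgHom (R := k) (S := k) (A := k) (M := M) (N := N)).comp
    (Algebra.TensorProduct.map (Algebra.lsmul k k M) (Algebra.lsmul k k N))).comp
      ((Algebra.TensorProduct.opAlgEquiv k k A A).symm.toAlgHom.comp
        (AlgHom.op (Bialgebra.comulAlgHom k A)))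

instance rightTensorModule : Module Aᵐᵒᵖ (RightTensor k M N) :=
  Module.compHom (M ⊗[k] N) (diagonalAction k A M N).toRingHom

/-- The Chevalley property: the tensor product of two simple (right) modules is semisimple. -/
def ChevalleyProperty : Prop :=
  ∀ (M N : Type u) [AddCommGroup M] [Module k M] [Module Aᵐᵒᵖ M] [IsScalarTower k Aᵐᵒᵖ M]
    [AddCommGroup N] [Module k N] [Module Aᵐᵒᵖ N] [IsScalarTower k Aᵐᵒᵖ N],
    IsSimpleModule Aᵐᵒᵖ M → IsSimpleModule Aᵐᵒᵖ N → IsSemisimpleModule Aᵐᵒᵖ (RightTensor k M N)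

end Chevalley

/-! ### Pointed coalgebras and the dual coalgebra -/

section Pointed

variable {k : Type v} [Field k]

/-- A subcoalgebra of `C`: a subspace `D` with `Δ(D) ⊆ D ⊗ D`. -/
def IsSubcoalgebra {C : Type u} [AddCommGroup C] [Module k C] [Coalgebra k C]
    (D : Submodule k C) : Prop :=
  ∀ x ∈ D, Coalgebra.comul (R := k) x ∈ LinearMap.range (TensorProduct.map D.subtype D.subtype)

/-- A simple subcoalgebra: nonzero and without proper nonzero subcoalgebras. -/
def IsSimpleSubcoalgebra {C : Type u} [AddCommGroup C] [Module k C] [Coalgebra k C]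
    (D : Submodule k C) : Prop :=
  IsSubcoalgebra D ∧ D ≠ ⊥ ∧ ∀ E : Submodule k C, IsSubcoalgebra E → E ≤ D → E = ⊥ ∨ E = D

variable (k) in
/-- A coalgebra is pointed if its simple subcoalgebras are one-dimensional. -/
def IsPointed (C : Type u) [AddCommGroup C] [Module k C] [Coalgebra k C] : Prop :=
  ∀ D : Submodule k C, IsSimpleSubcoalgebra D → Module.finrank k D = 1

variable (k) in
/-- The comultiplication of the dual of a finite-dimensional algebra: the transpose of the
multiplication, followed by `(A ⊗ A)* ≅ A* ⊗ A*`. -/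
def dualComul (A : Type u) [Ring A] [Algebra k A] [FiniteDimensional k A] :
    Module.Dual k A →ₗ[k] Module.Dual k A ⊗[k] Module.Dual k A :=
  (TensorProduct.dualDistribEquiv k A A).symm.toLinearMap ∘ₗ
    Module.Dual.transpose (LinearMap.mul' k A)

theorem dualDistrib_dualComul {A : Type u} [Ring A] [Algebra k A] [FiniteDimensional k A]
    (f : Module.Dual k A) (a b : A) :
    TensorProduct.dualDistrib k A A (dualComul k A f) (a ⊗ₜ b) = f (a * b) := by
  have h := (TensorProduct.dualDistribEquiv k A A).apply_symm_apply
    (Module.Dual.transpose (LinearMap.mul' k A) f)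
  exact LinearMap.congr_fun h (a ⊗ₜ b)

/-- Elements of `A* ⊗ A* ⊗ A*` are determined by their values on `A × A × A`. -/
theorem dual_tensor₃_ext {A : Type u} [Ring A] [Algebra k A] [FiniteDimensional k A]
    {x y : Module.Dual k A ⊗[k] (Module.Dual k A ⊗[k] Module.Dual k A)}
    (h : ∀ a b c : A,
      TensorProduct.dualDistrib k A (A ⊗[k] A)
        ((TensorProduct.dualDistrib k A A).lTensor _ x) (a ⊗ₜ (b ⊗ₜ c)) =
      TensorProduct.dualDistrib k A (A ⊗[k] A)
        ((TensorProduct.dualDistrib k A A).lTensor _ y) (a ⊗ₜ (b ⊗ₜ c))) : x = y := by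
  have h₁ : Function.Injective (TensorProduct.dualDistrib k A A) :=
    (TensorProduct.dualDistribEquiv k A A).injective
  have h₂ : Function.Injective (TensorProduct.dualDistrib k A (A ⊗[k] A)) :=
    (TensorProduct.dualDistribEquiv k A (A ⊗[k] A)).injective
  refine Module.Flat.lTensor_preserves_injective_linearMap _ h₁ (h₂ ?_)
  refine TensorProduct.ext' fun a z => ?_
  induction z with
  | zero => simp only [TensorProduct.tmul_zero, map_zero]
  | add z w hz hw => simp only [TensorProduct.tmul_add, map_add, hz, hw]
  | tmul b c => exact h a b c

theorem dual_assoc_eval {A : Type u} [Ring A] [Algebra k A] [FiniteDimensional k A]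
    (y : Module.Dual k A ⊗[k] Module.Dual k A) (a b c : A) :
    TensorProduct.dualDistrib k A (A ⊗[k] A) ((TensorProduct.dualDistrib k A A).lTensor _
        (TensorProduct.assoc k _ _ _ ((dualComul k A).rTensor _ y))) (a ⊗ₜ (b ⊗ₜ c)) =
      TensorProduct.dualDistrib k A A y ((a * b) ⊗ₜ c) := by
  induction y with
  | zero => simp only [map_zero, LinearMap.zero_apply]
  | add y z hy hz => simp only [map_add, LinearMap.add_apply, hy, hz]
  | tmul f g =>
    rw [LinearMap.rTensor_tmul, TensorProduct.dualDistrib_apply, ← dualDistrib_dualComul]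
    generalize dualComul k A f = z
    induction z with
    | zero => simp
    | add y z hy hz => simp only [TensorProduct.add_tmul, map_add, LinearMap.add_apply, hy, hz,
        add_mul]
    | tmul p q => simp [mul_assoc]

theorem dual_lTensor_eval {A : Type u} [Ring A] [Algebra k A] [FiniteDimensional k A]
    (y : Module.Dual k A ⊗[k] Module.Dual k A) (a b c : A) :
    TensorProduct.dualDistrib k A (A ⊗[k] A) ((TensorProduct.dualDistrib k A A).lTensor _
        ((dualComul k A).lTensor _ y)) (a ⊗ₜ (b ⊗ₜ c)) =
      TensorProduct.dualDistrib k A A y (a ⊗ₜ (b * c)) := by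
  induction y with
  | zero => simp only [map_zero, LinearMap.zero_apply]
  | add y z hy hz => simp only [map_add, LinearMap.add_apply, hy, hz]
  | tmul f g => simp [dualDistrib_dualComul]

theorem dual_lid_eval {A : Type u} [Ring A] [Algebra k A] [FiniteDimensional k A]
    (y : Module.Dual k A ⊗[k] Module.Dual k A) (a : A) :
    TensorProduct.lid k _ ((Module.Dual.eval k A 1).rTensor _ y) a =
      TensorProduct.dualDistrib k A A y (1 ⊗ₜ a) := by
  induction y with
  | zero => simp only [map_zero, LinearMap.zero_apply]
  | add y z hy hz => simp only [map_add, LinearMap.add_apply, hy, hz]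
  | tmul f g => simp

theorem dual_rid_eval {A : Type u} [Ring A] [Algebra k A] [FiniteDimensional k A]
    (y : Module.Dual k A ⊗[k] Module.Dual k A) (a : A) :
    TensorProduct.rid k _ ((Module.Dual.eval k A 1).lTensor _ y) a =
      TensorProduct.dualDistrib k A A y (a ⊗ₜ 1) := by
  induction y with
  | zero => simp only [map_zero, LinearMap.zero_apply]
  | add y z hy hz => simp only [map_add, LinearMap.add_apply, hy, hz]
  | tmul f g => simp [mul_comm]

variable (k) in
/-- The dual coalgebra `A*` of a finite-dimensional algebra `A`; the counit is evaluation at `1`. -/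
@[reducible] def dualCoalgebra (A : Type u) [Ring A] [Algebra k A] [FiniteDimensional k A] :
    Coalgebra k (Module.Dual k A) where
  comul := dualComul k A
  counit := Module.Dual.eval k A 1
  coassoc := LinearMap.ext fun f => dual_tensor₃_ext fun a b c => by
    refine (dual_assoc_eval _ a b c).trans (Eq.trans ?_ (dual_lTensor_eval _ a b c).symm)
    rw [dualDistrib_dualComul, dualDistrib_dualComul, mul_assoc]
  rTensor_counit_comp_comul := LinearMap.ext fun f => (TensorProduct.lid k _).injective <|
    LinearMap.ext fun a => by
      refine (dual_lid_eval _ a).trans ?_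
      rw [dualDistrib_dualComul]
      simp
  lTensor_counit_comp_comul := LinearMap.ext fun f => (TensorProduct.rid k _).injective <|
    LinearMap.ext fun a => by
      refine (dual_rid_eval _ a).trans ?_
      rw [dualDistrib_dualComul]
      simp

variable (k) in
/-- The dual `A*` of the finite-dimensional algebra `A` is pointed. -/
def DualIsPointed (A : Type u) [Ring A] [Algebra k A] [FiniteDimensional k A] : Prop :=
  letI := dualCoalgebra k A
  IsPointed k (Module.Dual k A)

end Pointed

end HopfDepth

end

/-! For a bimodule `M` with right `H`-action, `M ⊗_R H ≅ M ⊗ V` with diagonal right action, by `m ⊗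
h ↦ (m ⊗ 1̄) h`; the inverse untwists with the antipode (`inducedIso`). Iterating, the `(n+1)`-fold
tensor power of `H` over `R` becomes `H ⊗ V^{⊗n}` (`tensorPowIso`), and `H ⊗ -` turns divisibility
between powers of `V` over `R` into divisibility of `H`-`R`-bimodules
(`summandOfMultiple_diag_restrict`). The class `1̄` spans a trivial `R`-submodule of `V`, split off
by the counit, so `V^{⊗n}` is always an `R`-summand of `V^{⊗(n+1)}`. Hence the depth is finite as
soon as, for one `n ≥ 1`, `V^{⊗(n+1)}` divides a multiple of `V^{⊗n}` over `R` (`minDepth_lt_top`).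

Each condition produces such an `n` by letting an invariant of the powers of `V` become stationary.
For finite representation type it is the set of indecomposables that divide a multiple of `V^{⊗n}`
over `R`. If `V` is projective, so are its tensor powers (`summandOfMultiple_tensor_self`), and the
invariant is the trace ideal, which increases in a Noetherian ring. If `V` is semisimple and `R` has
the Chevalley property, all powers are semisimple, and the invariant is the annihilator, which
decreases in an Artinian ring. In the last two cases equal invariants mean that `V^{⊗n}` generates
`V^{⊗(n+1)}`, and the resulting surjection from copies of `V^{⊗n}` splits.

If `R*` is pointed, the annihilator of a simple module `M` has an orthogonal in `R*` containing a
one-dimensional subcoalgebra. This gives a one-dimensional module into which `M` embeds, so tensor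
products of simple modules have dimension one and are semisimple. -/

noncomputable section

namespace HopfDepth

/-! ### Direct summands of multiples, trace ideals and annihilators. -/

section SummandOfMultiple

/-- `M` is a direct summand of a multiple of `N`, expressed by morphisms `fᵢ : M → N` and
`gᵢ : N → M` with `∑ gᵢ fᵢ = 1`. -/
def SummandOfMultiple (S : Type*) [Ring S] (M N : Type*) [AddCommGroup M] [Module S M]
    [AddCommGroup N] [Module S N] : Prop :=
  ∃ (q : ℕ) (f : Fin q → M →ₗ[S] N) (g : Fin q → N →ₗ[S] M), ∑ i, g i ∘ₗ f i = LinearMap.id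

variable {S : Type*} [Ring S] {M N P : Type*} [AddCommGroup M] [Module S M]
  [AddCommGroup N] [Module S N] [AddCommGroup P] [Module S P]

namespace SummandOfMultiple

theorem of_fintype {ι : Type*} [Fintype ι] (f : ι → M →ₗ[S] N) (g : ι → N →ₗ[S] M)
    (h : ∑ i, g i ∘ₗ f i = LinearMap.id) : SummandOfMultiple S M N := by
  refine ⟨Fintype.card ι, f ∘ (Fintype.equivFin ι).symm, g ∘ (Fintype.equivFin ι).symm, ?_⟩
  rw [← h]
  exact (Fintype.equivFin ι).symm.sum_comp fun i => g i ∘ₗ f i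

theorem of_retract (f : M →ₗ[S] N) (g : N →ₗ[S] M) (h : g ∘ₗ f = LinearMap.id) :
    SummandOfMultiple S M N :=
  ⟨1, fun _ => f, fun _ => g, by simpa using h⟩

theorem of_equiv (e : M ≃ₗ[S] N) : SummandOfMultiple S M N :=
  of_retract e.toLinearMap e.symm.toLinearMap (by ext; simp)

theorem trans (h : SummandOfMultiple S M N) (h' : SummandOfMultiple S N P) :
    SummandOfMultiple S M P := by
  obtain ⟨q, f, g, hfg⟩ := h
  obtain ⟨r, f', g', hfg'⟩ := h'
  refine of_fintype (ι := Fin q × Fin r) (fun i => f' i.2 ∘ₗ f i.1) (fun i => g i.1 ∘ₗ g' i.2) ?_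
  rw [Fintype.sum_prod_type, ← hfg]
  refine Finset.sum_congr rfl fun i _ => LinearMap.ext fun x => ?_
  have := congrArg (g i) (LinearMap.congr_fun hfg' (f i x))
  simpa using this

/-- The `fᵢ` and `gᵢ` assemble to `M → N^q → M` with composite the identity. The complement is the
kernel of the second map, which lies in the universe that `DividesMultiple` asks for. -/
theorem dividesMultiple {S : Type v} [Ring S] {M N : Type u} [AddCommGroup M] [Module S M]
    [AddCommGroup N] [Module S N] (h : SummandOfMultiple S M N) : DividesMultiple S M N := by
  obtain ⟨q, f, g, hfg⟩ := h
  let i : M →ₗ[S] (Fin q → N) := LinearMap.pi f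
  let p : (Fin q → N) →ₗ[S] M := ∑ j, g j ∘ₗ LinearMap.proj j
  have hpi : ∀ x, p (i x) = x := fun x => by
    simpa [p, i] using LinearMap.congr_fun hfg x
  refine ⟨q, LinearMap.ker p, inferInstance, inferInstance, ⟨LinearEquiv.ofBijective
    (i.coprod (LinearMap.ker p).subtype) ⟨?_, fun y => ⟨(p y, ⟨y - i (p y), ?_⟩), ?_⟩⟩⟩⟩
  · refine (injective_iff_map_eq_zero _).mpr fun x hx => ?_
    have h₁ : x.1 = 0 := by simpa [hpi] using congrArg p hx
    have h₂ : x.2 = 0 := by simpa [h₁] using hx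
    exact Prod.ext h₁ h₂
  · simp [hpi]
  · simp

/-- A finite generating set of `M` has images supported on finitely many indices, so the section `s`
only meets a finite direct sum. -/
theorem of_finsupp_section [Module.Finite S M] {ι : Type*} (s : M →ₗ[S] (ι →₀ N))
    (p : (ι →₀ N) →ₗ[S] M) (h : p ∘ₗ s = LinearMap.id) : SummandOfMultiple S M N := by
  classical
  obtain ⟨T, hT⟩ := Module.Finite.fg_top (R := S) (M := M)
  let F : Finset ι := T.biUnion fun t => (s t).support
  have hF : ∀ m, (s m).support ⊆ F := by
    have : Submodule.span S (T : Set M) ≤ (Finsupp.supported N S (F : Set ι)).comap s := by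
      refine Submodule.span_le.mpr fun t ht => ?_
      refine (Finsupp.mem_supported S _).mpr ?_
      exact_mod_cast Finset.subset_biUnion_of_mem (fun t => (s t).support) ht
    intro m
    have hm := this (hT ▸ Submodule.mem_top : m ∈ _)
    exact_mod_cast (Finsupp.mem_supported S _).mp hm
  refine of_fintype (ι := F) (fun i => Finsupp.lapply i.1 ∘ₗ s) (fun i => p ∘ₗ Finsupp.lsingle i.1)
    (LinearMap.ext fun m => ?_)
  refine Eq.trans ?_ (LinearMap.congr_fun h m)
  simp only [LinearMap.sum_apply, LinearMap.comp_apply, Finsupp.lapply_apply,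
    Finsupp.lsingle_apply, ← map_sum]
  congr 1
  rw [Finset.sum_coe_sort F fun i => Finsupp.single i (s m i)]
  conv_rhs => rw [← Finsupp.sum_single (s m)]
  exact (Finsupp.sum_of_support_subset _ (hF m) _ (by simp)).symm

/-- If the images of the homomorphisms `N → M` span `M`, then `M` is a quotient of a direct sum of
copies of `N`. -/
theorem surjective_lsum (h : ⨆ f : N →ₗ[S] M, LinearMap.range f = ⊤) :
    Function.Surjective (Finsupp.lsum ℕ (fun f : N →ₗ[S] M => f)) := by
  rw [← LinearMap.range_eq_top, eq_top_iff, ← h]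
  refine iSup_le fun f => ?_
  rintro _ ⟨x, rfl⟩
  exact ⟨Finsupp.single f x, by simp⟩

/-- The surjection of `surjective_lsum` from copies of `N` splits because its target is projective;
in `of_isSemisimpleModule` it splits because its source is semisimple. -/
theorem of_projective [Module.Finite S M] [Module.Projective S M]
    (h : ⨆ f : N →ₗ[S] M, LinearMap.range f = ⊤) : SummandOfMultiple S M N := by
  obtain ⟨s, hs⟩ := Module.projective_lifting_property
    (Finsupp.lsum ℕ (fun f : N →ₗ[S] M => f)) LinearMap.id (surjective_lsum h)
  exact of_finsupp_section s _ hs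

theorem of_isSemisimpleModule [Module.Finite S M] [IsSemisimpleModule S N]
    (h : ⨆ f : N →ₗ[S] M, LinearMap.range f = ⊤) : SummandOfMultiple S M N := by
  obtain ⟨s, hs⟩ := IsSemisimpleModule.lifting_property
    (Finsupp.lsum ℕ (fun f : N →ₗ[S] M => f)) (surjective_lsum h) LinearMap.id
  exact of_finsupp_section s _ hs

end SummandOfMultiple

theorem projective_of_summandOfMultiple_self (h : SummandOfMultiple S M S) :
    Module.Projective S M := by
  obtain ⟨q, f, g, hfg⟩ := h
  refine Module.Projective.of_split (LinearMap.pi f) (∑ j, g j ∘ₗ LinearMap.proj j)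
    (LinearMap.ext fun x => ?_)
  simpa using LinearMap.congr_fun hfg x

theorem summandOfMultiple_self_of_projective [Module.Finite S M] [Module.Projective S M] :
    SummandOfMultiple S M S := by
  refine SummandOfMultiple.of_projective (eq_top_iff.mpr fun m _ => ?_)
  exact Submodule.mem_iSup_of_mem (LinearMap.toSpanSingleton S M m) ⟨1, by simp⟩

/-- A semisimple module generates every module with larger annihilator. -/
theorem iSup_range_eq_top_of_annihilator_le (k : Type*) [Field k] [Algebra k S] [Module k N]
    [IsScalarTower k S N] [Module.Finite k N] [IsSemisimpleModule S N]
    (h : Module.annihilator S N ≤ Module.annihilator S M) :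
    ⨆ f : N →ₗ[S] M, LinearMap.range f = ⊤ := by
  refine eq_top_iff.mpr fun m _ => ?_
  obtain ⟨T, hT⟩ := Module.Finite.fg_top (R := k) (M := N)
  -- Evaluation on a finite `k`-spanning set has kernel exactly the annihilator of `N`, so it embeds
  -- `S / Ann N` in `N^T`. The map `a ↦ a m` kills `Ann N`, hence factors through this image, and
  -- extends to `θ` on the semisimple module `N^T`.
  let ψ : S →ₗ[S] (T → N) := LinearMap.pi fun t => LinearMap.toSpanSingleton S N t
  let φ : S →ₗ[S] M := LinearMap.toSpanSingleton S M m
  have hker : LinearMap.ker ψ ≤ LinearMap.ker φ := by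
    intro a ha
    have haN : a ∈ Module.annihilator S N := by
      rw [Module.mem_annihilator]
      have : Submodule.span k (T : Set N) ≤ LinearMap.ker (Algebra.lsmul k k N a) := by
        refine Submodule.span_le.mpr fun t ht => ?_
        simpa [ψ] using congrFun (LinearMap.mem_ker.mp ha) ⟨t, ht⟩
      intro n
      simpa using this (hT ▸ Submodule.mem_top : n ∈ _)
    simpa [φ] using Module.mem_annihilator.mp (h haN) m
  let θ₀ : LinearMap.range ψ →ₗ[S] M :=
    (LinearMap.ker ψ).liftQ φ hker ∘ₗ ψ.quotKerEquivRange.symm.toLinearMap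
  obtain ⟨θ, hθ⟩ := IsSemisimpleModule.extension_property (LinearMap.range ψ).subtype
    Subtype.val_injective θ₀
  have hm : θ (ψ 1) = m := by
    have h₁ : θ (ψ 1) = θ₀ ⟨ψ 1, 1, rfl⟩ := LinearMap.congr_fun hθ ⟨ψ 1, 1, rfl⟩
    have h₂ : ψ.quotKerEquivRange.symm ⟨ψ 1, 1, rfl⟩ = (LinearMap.ker ψ).mkQ 1 :=
      ψ.quotKerEquivRange.symm_apply_eq.mpr rfl
    rw [h₁, LinearMap.comp_apply, LinearEquiv.coe_coe, h₂]
    simp [φ]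
  classical
  rw [← hm, ← Finset.univ_sum_single (ψ 1), map_sum]
  exact Submodule.sum_mem _ fun t _ =>
    Submodule.mem_iSup_of_mem (θ ∘ₗ LinearMap.single S (fun _ => N) t) ⟨ψ 1 t, rfl⟩

/-- In a tower `⋯ ↠ M₂ ↠ M₁ ↠ M₀` of finitely generated projective modules, some `Mₙ₊₁` is a direct
summand of a multiple of `Mₙ`. -/
theorem exists_summandOfMultiple_of_projective [IsNoetherianRing S] (M : ℕ → Type*)
    [∀ n, AddCommGroup (M n)] [∀ n, Module S (M n)] (hM : ∀ n, SummandOfMultiple S (M n) S)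
    [∀ n, Module.Finite S (M n)]
    (p : ∀ n, M (n + 1) →ₗ[S] M n) (hp : ∀ n, Function.Surjective (p n)) :
    ∃ n, SummandOfMultiple S (M (n + 1)) (M n) := by
  -- The trace ideals increase: a functional on `M n` composed with the surjection `p n` has the
  -- same range.
  let I : ℕ →o Ideal S := ⟨fun n => ⨆ f : M n →ₗ[S] S, LinearMap.range f,
    monotone_nat_of_le_succ fun n => iSup_le fun f => by
      refine le_trans ?_ (le_iSup _ (f ∘ₗ p n))
      rw [LinearMap.range_comp, LinearMap.range_eq_top.mpr (hp n), Submodule.map_top]⟩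
  obtain ⟨n, hn⟩ := monotone_stabilizes_iff_noetherian.mpr ‹IsNoetherianRing S› I
  have hI : (⨆ f : M (n + 1) →ₗ[S] S, LinearMap.range f) ≤
      ⨆ f : M n →ₗ[S] S, LinearMap.range f := (hn (n + 1) n.le_succ).ge
  have := projective_of_summandOfMultiple_self (hM (n + 1))
  refine ⟨n, SummandOfMultiple.of_projective (eq_top_iff.mpr fun x _ => ?_)⟩
  obtain ⟨q, f, g, hfg⟩ := hM (n + 1)
  rw [show x = ∑ i, g i (f i x) by simpa using (LinearMap.congr_fun hfg x).symm]
  -- The coefficient `f i x` lies in the trace ideal of `M (n + 1)`, hence in that of `M n`. It is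
  -- therefore a sum of values of functionals on `M n`, which `g i` carries into images of `M n` in
  -- `M (n + 1)`.
  refine Submodule.sum_mem _ fun i _ => ?_
  have hfx := hI (Submodule.mem_iSup_of_mem (f i) ⟨x, rfl⟩)
  have : (⨆ f : M n →ₗ[S] S, LinearMap.range f) ≤
      (⨆ f : M n →ₗ[S] M (n + 1), LinearMap.range f).comap (g i) := by
    refine iSup_le fun l => ?_
    rintro _ ⟨y, rfl⟩
    exact Submodule.mem_iSup_of_mem (g i ∘ₗ l) ⟨y, rfl⟩
  exact this hfx

/-- In a tower `⋯ ↠ M₂ ↠ M₁ ↠ M₀` of finite-dimensional semisimple modules, some `Mₙ₊₁` is a direct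
summand of a multiple of `Mₙ`. -/
theorem exists_summandOfMultiple_of_isSemisimpleModule (k : Type*) [Field k] [Algebra k S]
    [IsArtinianRing S] (M : ℕ → Type*)
    [∀ n, AddCommGroup (M n)] [∀ n, Module k (M n)] [∀ n, Module S (M n)]
    [∀ n, IsScalarTower k S (M n)] [∀ n, Module.Finite k (M n)]
    (hM : ∀ n, IsSemisimpleModule S (M n))
    (p : ∀ n, M (n + 1) →ₗ[S] M n) (hp : ∀ n, Function.Surjective (p n)) :
    ∃ n, SummandOfMultiple S (M (n + 1)) (M n) := by
  -- Annihilators shrink along the tower because each `M n` is a quotient of `M (n + 1)`; the order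
  -- dual makes the chain increasing.
  let I : ℕ →o (Ideal S)ᵒᵈ := ⟨fun n => OrderDual.toDual (Module.annihilator S (M n)),
    monotone_nat_of_le_succ fun n => (p n).annihilator_le_of_surjective (hp n)⟩
  obtain ⟨n, hn⟩ := IsArtinian.monotone_stabilizes I
  have hI : Module.annihilator S (M n) ≤ Module.annihilator S (M (n + 1)) :=
    (congrArg OrderDual.ofDual (hn (n + 1) n.le_succ)).le
  have := Module.Finite.of_restrictScalars_finite k S (M (n + 1))
  exact ⟨n, SummandOfMultiple.of_isSemisimpleModule (iSup_range_eq_top_of_annihilator_le k hI)⟩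

end SummandOfMultiple

/-! ### Right modules, restriction and finite representation type. -/

/-- A right `A`-module, with its underlying `k`-module structure. -/
structure KRightMod (k : Type v) (A : Type u) [Field k] [Ring A] [Algebra k A] where
  carrier : Type u
  [addCommGroup : AddCommGroup carrier]
  [moduleBase : Module k carrier]
  [moduleRight : Module Aᵐᵒᵖ carrier]
  [tower : IsScalarTower k Aᵐᵒᵖ carrier]

namespace KRightMod

attribute [instance] addCommGroup moduleBase moduleRight tower

variable {k : Type v} [Field k] {A B : Type u} [Ring A] [Algebra k A] [Ring B] [Algebra k B]

/-- Restriction of a right module along an algebra homomorphism. -/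
def restrict (f : B →ₐ[k] A) (M : KRightMod k A) : KRightMod k B :=
  letI : Module Bᵐᵒᵖ M.carrier := Module.compHom M.carrier (AlgHom.op f).toRingHom
  { carrier := M.carrier
    tower := ⟨fun t d m => by
      change AlgHom.op f (t • d) • m = t • (AlgHom.op f d • m)
      rw [map_smul, smul_assoc]⟩ }

/-- A homomorphism of right `A`-modules as a homomorphism of the restricted modules. -/
def restrictMap (f : B →ₐ[k] A) {M N : KRightMod k A} (φ : M.carrier →ₗ[Aᵐᵒᵖ] N.carrier) :
    (M.restrict f).carrier →ₗ[Bᵐᵒᵖ] (N.restrict f).carrier where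
  toFun := φ
  map_add' := φ.map_add
  map_smul' b := φ.map_smul (AlgHom.op f b)

theorem summandOfMultiple_restrict (f : B →ₐ[k] A) {M N : KRightMod k A}
    (h : SummandOfMultiple Aᵐᵒᵖ M.carrier N.carrier) :
    SummandOfMultiple Bᵐᵒᵖ (M.restrict f).carrier (N.restrict f).carrier := by
  obtain ⟨q, φ, ψ, hq⟩ := h
  refine ⟨q, fun i => restrictMap f (φ i), fun i => restrictMap f (ψ i), LinearMap.ext fun x => ?_⟩
  have hx := LinearMap.congr_fun hq (show M.carrier from x)
  rw [LinearMap.sum_apply] at hx ⊢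
  exact hx

/-- A submodule as a right module. -/
def ofSubmodule (M : KRightMod k A) (X : Submodule Aᵐᵒᵖ M.carrier) : KRightMod k A where
  carrier := X

/-- The decomposition is over `A` and the divisibility only over `B`. This mixture lets
indecomposables over `H` control divisibility over `R`. -/
theorem summandOfMultiple_restrict_of_isCompl (f : B →ₐ[k] A) {M N : KRightMod k A}
    {X Y : Submodule Aᵐᵒᵖ M.carrier} (h : IsCompl X Y)
    (hX : SummandOfMultiple Bᵐᵒᵖ ((M.ofSubmodule X).restrict f).carrier (N.restrict f).carrier)
    (hY : SummandOfMultiple Bᵐᵒᵖ ((M.ofSubmodule Y).restrict f).carrier (N.restrict f).carrier) :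
    SummandOfMultiple Bᵐᵒᵖ (M.restrict f).carrier (N.restrict f).carrier := by
  obtain ⟨q, φ, ψ, hq⟩ := hX
  obtain ⟨r, φ', ψ', hr⟩ := hY
  let iX := restrictMap f (M := M.ofSubmodule X) (N := M) X.subtype
  let iY := restrictMap f (M := M.ofSubmodule Y) (N := M) Y.subtype
  let pX := restrictMap f (M := M) (N := M.ofSubmodule X) (X.projectionOnto Y h)
  let pY := restrictMap f (M := M) (N := M.ofSubmodule Y) (Y.projectionOnto X h.symm)
  refine SummandOfMultiple.of_fintype (ι := Fin q ⊕ Fin r)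
    (Sum.elim (fun i => φ i ∘ₗ pX) (fun i => φ' i ∘ₗ pY))
    (Sum.elim (fun i => iX ∘ₗ ψ i) (fun i => iY ∘ₗ ψ' i)) ?_
  ext x
  have h₁ := congrArg iX (LinearMap.congr_fun hq (pX x))
  have h₂ := congrArg iY (LinearMap.congr_fun hr (pY x))
  simp only [LinearMap.sum_apply, LinearMap.comp_apply, map_sum, LinearMap.id_apply] at h₁ h₂
  simp only [Fintype.sum_sum_type, Sum.elim_inl, Sum.elim_inr, LinearMap.add_apply,
    LinearMap.sum_apply, LinearMap.comp_apply, h₁, h₂, LinearMap.id_apply]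
  exact Submodule.projection_add_projection_eq_self h x

/-- A property of finite-dimensional modules which is inherited by direct sums holds for `M` if it
holds for the indecomposable direct summands of `M`. -/
theorem induction_indecomposable {C : KRightMod k A → Prop}
    (hzero : ∀ M : KRightMod k A, Subsingleton M.carrier → C M)
    (hadd : ∀ (M : KRightMod k A) (X Y : Submodule Aᵐᵒᵖ M.carrier), IsCompl X Y →
      C (M.ofSubmodule X) → C (M.ofSubmodule Y) → C M)
    (M : KRightMod k A) [Module.Finite k M.carrier]
    (hind : ∀ X : KRightMod k A, Module.Finite k X.carrier → IsIndecomposable Aᵐᵒᵖ X.carrier →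
      (∃ (i : X.carrier →ₗ[Aᵐᵒᵖ] M.carrier) (p : M.carrier →ₗ[Aᵐᵒᵖ] X.carrier),
        p ∘ₗ i = LinearMap.id) → C X) : C M := by
  induction hd : Module.finrank k M.carrier using Nat.strong_induction_on generalizing M with
  | _ d ih =>
  subst hd
  rcases subsingleton_or_nontrivial M.carrier with hM | hM
  · exact hzero M hM
  by_cases hi : IsIndecomposable Aᵐᵒᵖ M.carrier
  · exact hind M ‹_› hi ⟨LinearMap.id, LinearMap.id, rfl⟩
  have hex : ∃ N P : Submodule Aᵐᵒᵖ M.carrier, IsCompl N P ∧ N ≠ ⊥ ∧ P ≠ ⊥ := by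
    by_contra! hcon
    exact hi ⟨hM, fun N P hNP => or_iff_not_imp_left.mpr (hcon N P hNP)⟩
  -- A proper summand has smaller dimension, and its own summands are summands of `M`, so `hind` is
  -- inherited and the induction on dimension applies.
  have key : ∀ X Y : Submodule Aᵐᵒᵖ M.carrier, IsCompl X Y → Y ≠ ⊥ → C (M.ofSubmodule X) := by
    intro X Y hXY hY
    have hXt : X ≠ ⊤ := fun h => hY (by simpa [h] using hXY.inf_eq_bot)
    let X' : Submodule k M.carrier := X.restrictScalars k
    have hlt : Module.finrank k X' < Module.finrank k M.carrier :=
      Submodule.finrank_lt fun h => hXt ((Submodule.restrictScalars_eq_top_iff _ _ _).mp h)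
    have hfin : Module.Finite k (M.ofSubmodule X).carrier :=
      inferInstanceAs (Module.Finite k X')
    refine ih _ hlt (M.ofSubmodule X) (fun Z hZ hZi ⟨i, p, hip⟩ => hind Z hZ hZi
      ⟨X.subtype ∘ₗ i, p ∘ₗ X.projectionOnto Y hXY, LinearMap.ext fun z => ?_⟩) rfl
    have : X.projectionOnto Y hXY (X.subtype (i z)) = i z :=
      Submodule.projectionOnto_apply_left hXY (i z)
    simp only [LinearMap.comp_apply]
    exact (congrArg p this).trans (LinearMap.congr_fun hip z)
  obtain ⟨N, P, hNP, hN, hP⟩ := hex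
  exact hadd M N P hNP (key N P hNP hP) (key P N hNP.symm hN)

/-- If `A` has finite representation type, then a sequence of finite-dimensional right `A`-modules
each of which is, over `B`, a direct summand of a multiple of the next one, becomes stationary
up to similarity over `B`. -/
theorem exists_summandOfMultiple_of_finiteRepresentationType (hA : FiniteRepresentationType A)
    (f : B →ₐ[k] A) (M : ℕ → KRightMod k A) [∀ n, Module.Finite k (M n).carrier]
    (h : ∀ n, SummandOfMultiple Bᵐᵒᵖ ((M n).restrict f).carrier ((M (n + 1)).restrict f).carrier) :
    ∃ n, SummandOfMultiple Bᵐᵒᵖ ((M (n + 1)).restrict f).carrier ((M n).restrict f).carrier := by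
  obtain ⟨t, F, hF⟩ := hA
  -- These subsets of a finite set increase by `h` and transitivity, so they become stationary. The
  -- copy `X` of `F i` is needed since `F i` carries no chosen `k`-structure.
  let I : ℕ →o Set (Fin t) := ⟨fun n => {i | ∃ X : KRightMod k A,
      Nonempty (X.carrier ≃ₗ[Aᵐᵒᵖ] F i) ∧
        SummandOfMultiple Bᵐᵒᵖ (X.restrict f).carrier ((M n).restrict f).carrier},
    monotone_nat_of_le_succ fun n i ⟨X, hX, hXM⟩ => ⟨X, hX, hXM.trans (h n)⟩⟩
  obtain ⟨n, hn⟩ := WellFoundedGT.monotone_chain_condition I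
  have hI : I (n + 1) ≤ I n := (hn (n + 1) n.le_succ).ge
  refine ⟨n, induction_indecomposable (C := fun X =>
    SummandOfMultiple Bᵐᵒᵖ (X.restrict f).carrier ((M n).restrict f).carrier) ?_ ?_ _ ?_⟩
  · intro X hX
    exact ⟨0, Fin.elim0, Fin.elim0, LinearMap.ext fun x => hX.elim _ _⟩
  · intro X Y Z hYZ hY hZ
    exact summandOfMultiple_restrict_of_isCompl f hYZ hY hZ
  · rintro X hXfin hX ⟨i, p, hip⟩
    have := Module.Finite.of_restrictScalars_finite k Aᵐᵒᵖ X.carrier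
    obtain ⟨j, ⟨e⟩⟩ := hF X.carrier hX
    have hXM : SummandOfMultiple Aᵐᵒᵖ X.carrier (M (n + 1)).carrier := .of_retract i p hip
    -- `X` is a summand of `M (n + 1)`, so its class is in `I (n + 1)` and hence in `I n`, where it
    -- is witnessed by another copy `Y`.
    obtain ⟨Y, ⟨e'⟩, hY⟩ := hI ⟨X, ⟨e⟩, summandOfMultiple_restrict f hXM⟩
    exact (summandOfMultiple_restrict f (.of_equiv (e.trans e'.symm))).trans hY

end KRightMod

/-! ### Diagonal actions and associativity of the tensor product. -/

section PairAct

variable {k : Type v} [Field k] {A : Type u} [Ring A] [Algebra k A]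

/-- Right multiplication on a right module. -/
def rightMul (M : Type*) [AddCommGroup M] [Module k M] [Module Aᵐᵒᵖ M] [IsScalarTower k Aᵐᵒᵖ M] :
    A →ₗ[k] Module.End k M :=
  (Algebra.lsmul k k M).toLinearMap ∘ₗ (MulOpposite.opLinearEquiv k).toLinearMap

theorem rightMul_apply (M : Type*) [AddCommGroup M] [Module k M] [Module Aᵐᵒᵖ M]
    [IsScalarTower k Aᵐᵒᵖ M] (a : A) (m : M) :
    rightMul (k := k) M a m = MulOpposite.op a • m := rfl

variable (M N : Type*) [AddCommGroup M] [Module k M] [Module Aᵐᵒᵖ M] [IsScalarTower k Aᵐᵒᵖ M]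
  [AddCommGroup N] [Module k N] [Module Aᵐᵒᵖ N] [IsScalarTower k Aᵐᵒᵖ N]

/-- The action `(m ⊗ n) (a ⊗ b) = m a ⊗ n b` of `A ⊗ A` on a tensor product of right modules. -/
def pairAct : A ⊗[k] A →ₗ[k] Module.End k (M ⊗[k] N) :=
  TensorProduct.map₂ (rightMul M) (rightMul N)

@[simp]
theorem pairAct_tmul (a b : A) (m : M) (n : N) :
    pairAct M N (a ⊗ₜ[k] b) (m ⊗ₜ n) = (MulOpposite.op a • m) ⊗ₜ (MulOpposite.op b • n) := rfl

theorem pairAct_mul (z w : A ⊗[k] A) (x : M ⊗[k] N) :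
    pairAct M N (z * w) x = pairAct M N w (pairAct M N z x) := by
  induction x with
  | zero => simp
  | add x y hx hy => simp only [map_add, hx, hy]
  | tmul m n =>
    induction z with
    | zero => simp
    | add z z' hz hz' => simp only [add_mul, map_add, LinearMap.add_apply, hz, hz']
    | tmul a b =>
      induction w with
      | zero => simp
      | add z z' hz hz' => simp only [mul_add, map_add, LinearMap.add_apply, hz, hz']
      | tmul c d => simp [mul_smul]

variable {M N} in
theorem pairAct_naturality {M' N' : Type*}
    [AddCommGroup M'] [Module k M'] [Module Aᵐᵒᵖ M'] [IsScalarTower k Aᵐᵒᵖ M']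
    [AddCommGroup N'] [Module k N'] [Module Aᵐᵒᵖ N'] [IsScalarTower k Aᵐᵒᵖ N']
    (φ : M →ₗ[k] M') (ψ : N →ₗ[k] N')
    (hφ : ∀ (a : A) m, φ (MulOpposite.op a • m) = MulOpposite.op a • φ m)
    (hψ : ∀ (a : A) n, ψ (MulOpposite.op a • n) = MulOpposite.op a • ψ n)
    (z : A ⊗[k] A) (x : M ⊗[k] N) :
    TensorProduct.map φ ψ (pairAct M N z x) = pairAct M' N' z (TensorProduct.map φ ψ x) := by
  induction x with
  | zero => simp
  | add x y hx hy => simp only [map_add, hx, hy]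
  | tmul m n =>
    induction z with
    | zero => simp
    | add z z' hz hz' => simp only [map_add, LinearMap.add_apply, hz, hz']
    | tmul a b => simp [hφ, hψ]

/-- The action `(m ⊗ (n ⊗ p)) (a ⊗ (b ⊗ c)) = m a ⊗ (n b ⊗ p c)`. -/
def tripleAct (P : Type*) [AddCommGroup P] [Module k P] [Module Aᵐᵒᵖ P] [IsScalarTower k Aᵐᵒᵖ P] :
    A ⊗[k] (A ⊗[k] A) →ₗ[k] Module.End k (M ⊗[k] (N ⊗[k] P)) :=
  TensorProduct.map₂ (rightMul M) (pairAct N P)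

theorem tripleAct_tmul (P : Type*) [AddCommGroup P] [Module k P] [Module Aᵐᵒᵖ P]
    [IsScalarTower k Aᵐᵒᵖ P] (a : A) (z : A ⊗[k] A) (m : M) (x : N ⊗[k] P) :
    tripleAct M N P (a ⊗ₜ z) (m ⊗ₜ x) = (MulOpposite.op a • m) ⊗ₜ pairAct N P z x := rfl

end PairAct

section Bialgebra

variable {k : Type v} [Field k] {A : Type u} [Ring A] [Bialgebra k A]

variable (M N : Type u) [AddCommGroup M] [Module k M] [Module Aᵐᵒᵖ M] [IsScalarTower k Aᵐᵒᵖ M]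
  [AddCommGroup N] [Module k N] [Module Aᵐᵒᵖ N] [IsScalarTower k Aᵐᵒᵖ N]

/-- Trades the composite of opposite-algebra maps for `pairAct`, whose identities can be checked on
pure tensors. -/
theorem diagonalAction_apply (a : A) :
    diagonalAction k A M N (MulOpposite.op a) = pairAct M N (Coalgebra.comul (R := k) a) := by
  suffices h : ∀ z : A ⊗[k] A, (Module.endTensorEndAlgHom (R := k) (S := k) (A := k)
      (M := M) (N := N)) (Algebra.TensorProduct.map (Algebra.lsmul k k M) (Algebra.lsmul k k N)
      ((Algebra.TensorProduct.opAlgEquiv k k A A).symm (MulOpposite.op z))) = pairAct M N z from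
    h (Coalgebra.comul a)
  intro z
  induction z with
  | zero => simp
  | add z w hz hw => simp only [MulOpposite.op_add, map_add, hz, hw]
  | tmul a b => rfl

variable (k) in
/-- The underlying vector space of the tensor product of two right modules. -/
def rightTensorEquiv (M N : Type u) [AddCommGroup M] [Module k M] [AddCommGroup N] [Module k N] :
    RightTensor k M N ≃ₗ[k] M ⊗[k] N :=
  LinearEquiv.refl k (M ⊗[k] N)

theorem rightTensorEquiv_op_smul (a : A) (x : RightTensor k M N) :
    rightTensorEquiv k M N (MulOpposite.op a • x) =
      pairAct M N (Coalgebra.comul (R := k) a) (rightTensorEquiv k M N x) :=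
  LinearMap.congr_fun (diagonalAction_apply M N a) (rightTensorEquiv k M N x)

theorem rightTensorEquiv_symm_pairAct (a : A) (x : M ⊗[k] N) :
    (rightTensorEquiv k M N).symm (pairAct M N (Coalgebra.comul (R := k) a) x) =
      MulOpposite.op a • (rightTensorEquiv k M N).symm x := by
  rw [LinearEquiv.symm_apply_eq, rightTensorEquiv_op_smul, LinearEquiv.apply_symm_apply]

instance : IsScalarTower k Aᵐᵒᵖ (RightTensor k M N) :=
  ⟨fun t a x => LinearMap.congr_fun (map_smul (diagonalAction k A M N) t a)
    (rightTensorEquiv k M N x)⟩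

variable (k) in
/-- The associativity isomorphism `(M ⊗ N) ⊗ P ≅ M ⊗ (N ⊗ P)`. -/
def rightTensorAssoc (M N P : Type u) [AddCommGroup M] [Module k M] [AddCommGroup N] [Module k N]
    [AddCommGroup P] [Module k P] :
    RightTensor k (RightTensor k M N) P ≃ₗ[k] RightTensor k M (RightTensor k N P) :=
  (rightTensorEquiv k (RightTensor k M N) P).trans <|
    (TensorProduct.congr (rightTensorEquiv k M N) (LinearEquiv.refl k P)).trans <|
    (TensorProduct.assoc k M N P).trans <|
    (TensorProduct.congr (LinearEquiv.refl k M) (rightTensorEquiv k N P).symm).trans <|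
    (rightTensorEquiv k M (RightTensor k N P)).symm

/-- The associativity isomorphism is compatible with the diagonal actions. -/
theorem rightTensorAssoc_op_smul (P : Type u) [AddCommGroup P] [Module k P] [Module Aᵐᵒᵖ P]
    [IsScalarTower k Aᵐᵒᵖ P] (a : A) (x : RightTensor k (RightTensor k M N) P) :
    rightTensorAssoc k M N P (MulOpposite.op a • x) =
      MulOpposite.op a • rightTensorAssoc k M N P x := by
  let e := TensorProduct.congr (rightTensorEquiv k M N) (LinearEquiv.refl k P)
  let e' := TensorProduct.congr (LinearEquiv.refl k M) (rightTensorEquiv k N P).symm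
  -- Seen in `M ⊗ (N ⊗ P)`, each bracketing makes `a` act through one of its two iterated
  -- coproducts; coassociativity identifies them.
  have hleft : ∀ (z : A ⊗[k] A) (x : RightTensor k M N ⊗[k] P),
      TensorProduct.assoc k M N P (e (pairAct (RightTensor k M N) P z x)) =
        tripleAct M N P (TensorProduct.assoc k A A A
          ((Coalgebra.comul (R := k) (A := A)).rTensor A z))
          (TensorProduct.assoc k M N P (e x)) := by
    intro z x
    induction z with
    | zero => simp
    | add z w hz hw => simp only [map_add, LinearMap.add_apply, hz, hw]
    | tmul p q =>
      induction x with
      | zero => simp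
      | add x y hx hy => simp only [map_add, hx, hy]
      | tmul x y =>
        obtain ⟨x, rfl⟩ := (rightTensorEquiv k M N).symm.surjective x
        simp only [pairAct_tmul, LinearMap.rTensor_tmul, e, TensorProduct.congr_tmul,
          rightTensorEquiv_op_smul, LinearEquiv.apply_symm_apply, LinearEquiv.refl_apply]
        generalize Coalgebra.comul (R := k) p = w
        induction x with
        | zero => simp
        | add x y hx hy => simp only [map_add, TensorProduct.add_tmul, hx, hy]
        | tmul m n =>
          induction w with
          | zero => simp
          | add z w hz hw => simp only [map_add, LinearMap.add_apply, TensorProduct.add_tmul, hz, hw]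
          | tmul a b => simp [tripleAct_tmul]
  have hright : ∀ (z : A ⊗[k] A) (x : M ⊗[k] (N ⊗[k] P)),
      e' (tripleAct M N P ((Coalgebra.comul (R := k) (A := A)).lTensor A z) x) =
        pairAct M (RightTensor k N P) z (e' x) := by
    intro z x
    induction z with
    | zero => simp
    | add z w hz hw => simp only [map_add, LinearMap.add_apply, hz, hw]
    | tmul p q =>
      induction x with
      | zero => simp
      | add x y hx hy => simp only [map_add, hx, hy]
      | tmul m x =>
        simp only [e', LinearMap.lTensor_tmul, tripleAct_tmul, TensorProduct.congr_tmul,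
          LinearEquiv.refl_apply, pairAct_tmul, rightTensorEquiv_symm_pairAct]
  simp only [rightTensorAssoc, LinearEquiv.trans_apply, rightTensorEquiv_op_smul]
  rw [hleft, Coalgebra.coassoc_apply, hright, rightTensorEquiv_symm_pairAct]

end Bialgebra

/-! ### Antipode identities. -/

section Hopf

variable {k : Type v} [Field k] {A : Type u} [Ring A] [HopfAlgebra k A]

open Coalgebra HopfAlgebra

/-- The left side is `∑ S(a₍₁₎) a₍₂₎ ⊗ a₍₃₎`: regrouping by coassociativity, the antipode axiom
turns the first leg into `ε`, and the counit axiom absorbs it. -/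
theorem sum_antipode_tmul_one_mul_comul {ι : Type*} {a : A} (r : Repr k a ι) :
    ∑ i ∈ r.index, (antipode k (r.left i) ⊗ₜ[k] (1 : A)) * comul (R := k) (r.right i) =
      1 ⊗ₜ a := by
  let K : A ⊗[k] (A ⊗[k] A) →ₗ[k] A ⊗[k] A :=
    (LinearMap.mul' k A ∘ₗ (antipode k).rTensor A).rTensor A ∘ₗ
      (TensorProduct.assoc k A A A).symm.toLinearMap
  have hK : ∀ (p : A) (z : A ⊗[k] A), K (p ⊗ₜ z) = (antipode k p ⊗ₜ 1) * z := by
    intro p z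
    induction z with
    | zero => simp
    | add z w hz hw => simp only [TensorProduct.tmul_add, map_add, mul_add, hz, hw]
    | tmul q s => simp [K]
  have h : K ((comul (R := k) (A := A)).lTensor A (comul a)) = 1 ⊗ₜ a := by
    simp only [K, LinearMap.comp_apply, LinearEquiv.coe_coe, coassoc_symm_apply]
    rw [← LinearMap.comp_apply, ← LinearMap.rTensor_comp, LinearMap.comp_assoc,
      mul_antipode_rTensor_comul, LinearMap.rTensor_comp_apply, rTensor_counit_comul]
    simp
  rw [← h, ← r.eq]
  simp [hK]

/-- The companion identity for `∑ a₍₁₎ S(a₍₂₎) ⊗ a₍₃₎`, from the other antipode axiom. -/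
theorem sum_tmul_one_mul_antipode_comul {ι : Type*} {a : A} (r : Repr k a ι) :
    ∑ i ∈ r.index, (r.left i ⊗ₜ[k] (1 : A)) *
      (antipode k).rTensor A (comul (R := k) (r.right i)) = 1 ⊗ₜ a := by
  let K : A ⊗[k] (A ⊗[k] A) →ₗ[k] A ⊗[k] A :=
    (LinearMap.mul' k A ∘ₗ (antipode k).lTensor A).rTensor A ∘ₗ
      (TensorProduct.assoc k A A A).symm.toLinearMap
  have hK : ∀ (p : A) (z : A ⊗[k] A), K (p ⊗ₜ z) = (p ⊗ₜ 1) * (antipode k).rTensor A z := by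
    intro p z
    induction z with
    | zero => simp
    | add z w hz hw => simp only [TensorProduct.tmul_add, map_add, mul_add, hz, hw]
    | tmul q s => simp [K]
  have h : K ((comul (R := k) (A := A)).lTensor A (comul a)) = 1 ⊗ₜ a := by
    simp only [K, LinearMap.comp_apply, LinearEquiv.coe_coe, coassoc_symm_apply]
    rw [← LinearMap.comp_apply, ← LinearMap.rTensor_comp, LinearMap.comp_assoc,
      mul_antipode_lTensor_comul, LinearMap.rTensor_comp_apply, rTensor_counit_comul]
    simp
  rw [← h, ← r.eq]
  simp [hK]

variable (M N : Type u) [AddCommGroup M] [Module k M] [Module Aᵐᵒᵖ M] [IsScalarTower k Aᵐᵒᵖ M]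
  [AddCommGroup N] [Module k N] [Module Aᵐᵒᵖ N] [IsScalarTower k Aᵐᵒᵖ N]

/-- `∑ (m S(a₍₁₎) ⊗ n) a₍₂₎ = m ⊗ n a`. -/
theorem sum_op_smul_antipode_tmul {ι : Type*} {a : A} (r : Repr k a ι) (m : M) (n : N) :
    ∑ i ∈ r.index, MulOpposite.op (r.right i) •
      (rightTensorEquiv k M N).symm ((MulOpposite.op (antipode k (r.left i)) • m) ⊗ₜ[k] n) =
    (rightTensorEquiv k M N).symm (m ⊗ₜ[k] (MulOpposite.op a • n)) := by
  have h := congrArg (fun z => pairAct M N z (m ⊗ₜ n)) (sum_antipode_tmul_one_mul_comul r)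
  simp only [map_sum, LinearMap.sum_apply, pairAct_mul, pairAct_tmul, MulOpposite.op_one,
    one_smul] at h
  simp only [← h, map_sum, rightTensorEquiv_symm_pairAct]

end Hopf

/-- A `k`-linear map commuting with the right action of `A` is a homomorphism of right modules. -/
def linearMapOfCommute {k : Type*} {A : Type*} [Field k] [Ring A] {M N : Type*}
    [AddCommGroup M] [Module k M] [Module Aᵐᵒᵖ M] [AddCommGroup N] [Module k N] [Module Aᵐᵒᵖ N]
    (φ : M →ₗ[k] N) (h : ∀ (a : A) m, φ (MulOpposite.op a • m) = MulOpposite.op a • φ m) :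
    M →ₗ[Aᵐᵒᵖ] N where
  toFun := φ
  map_add' := φ.map_add
  map_smul' a m := h a.unop m

/-! ### Tensor products of right modules: functoriality, projectivity, semisimplicity. -/

namespace KRightMod

section Bialgebra

variable {k : Type v} [Field k] {A B : Type u} [Ring A] [Bialgebra k A] [Ring B] [Bialgebra k B]

/-- The tensor product of two right modules, with the diagonal action. -/
def tensor (M N : KRightMod k A) : KRightMod k A where
  carrier := RightTensor k M.carrier N.carrier

/-- The underlying vector space of a tensor product. -/
def tensorEquiv (M N : KRightMod k A) : (M.tensor N).carrier ≃ₗ[k] M.carrier ⊗[k] N.carrier :=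
  rightTensorEquiv k M.carrier N.carrier

theorem tensorEquiv_op_smul (M N : KRightMod k A) (a : A) (x : (M.tensor N).carrier) :
    tensorEquiv M N (MulOpposite.op a • x) =
      pairAct M.carrier N.carrier (Coalgebra.comul (R := k) a) (tensorEquiv M N x) :=
  rightTensorEquiv_op_smul M.carrier N.carrier a x

theorem tensorEquiv_symm_pairAct (M N : KRightMod k A) (a : A) (x : M.carrier ⊗[k] N.carrier) :
    (tensorEquiv M N).symm (pairAct M.carrier N.carrier (Coalgebra.comul (R := k) a) x) =
      MulOpposite.op a • (tensorEquiv M N).symm x :=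
  rightTensorEquiv_symm_pairAct M.carrier N.carrier a x

instance (M N : KRightMod k A) [Module.Finite k M.carrier] [Module.Finite k N.carrier] :
    Module.Finite k (M.tensor N).carrier :=
  Module.Finite.equiv (tensorEquiv M N).symm

/-- The tensor product of two homomorphisms. -/
def tensorMap {M N M' N' : KRightMod k A} (φ : M.carrier →ₗ[Aᵐᵒᵖ] M'.carrier)
    (ψ : N.carrier →ₗ[Aᵐᵒᵖ] N'.carrier) :
    (M.tensor N).carrier →ₗ[Aᵐᵒᵖ] (M'.tensor N').carrier :=
  linearMapOfCommute ((tensorEquiv M' N').symm.toLinearMap ∘ₗ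
    TensorProduct.map (φ.restrictScalars k) (ψ.restrictScalars k) ∘ₗ
      (tensorEquiv M N).toLinearMap) fun a x => by
    simp only [LinearMap.comp_apply, LinearEquiv.coe_coe, tensorEquiv_op_smul]
    rw [pairAct_naturality _ _ (fun a m => φ.map_smul _ m) (fun a n => ψ.map_smul _ n),
      tensorEquiv_symm_pairAct]

theorem tensorMap_apply {M N M' N' : KRightMod k A} (φ : M.carrier →ₗ[Aᵐᵒᵖ] M'.carrier)
    (ψ : N.carrier →ₗ[Aᵐᵒᵖ] N'.carrier) (x : (M.tensor N).carrier) :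
    tensorMap φ ψ x = (tensorEquiv M' N').symm
      (TensorProduct.map (φ.restrictScalars k) (ψ.restrictScalars k) (tensorEquiv M N x)) := rfl

theorem summandOfMultiple_tensor (M : KRightMod k A) {N N' : KRightMod k A}
    (h : SummandOfMultiple Aᵐᵒᵖ N.carrier N'.carrier) :
    SummandOfMultiple Aᵐᵒᵖ (M.tensor N).carrier (M.tensor N').carrier := by
  obtain ⟨q, f, g, hfg⟩ := h
  refine ⟨q, fun i => tensorMap LinearMap.id (f i), fun i => tensorMap LinearMap.id (g i),
    LinearMap.ext fun x => ?_⟩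
  obtain ⟨x, rfl⟩ := (tensorEquiv M N).symm.surjective x
  simp only [LinearMap.sum_apply, LinearMap.comp_apply, tensorMap_apply,
    LinearEquiv.apply_symm_apply, LinearMap.id_apply, ← map_sum]
  congr 1
  induction x with
  | zero => simp
  | add x y hx hy => simp only [map_add, Finset.sum_add_distrib, hx, hy]
  | tmul m n =>
    have hn := LinearMap.congr_fun hfg n
    simp only [LinearMap.sum_apply, LinearMap.comp_apply, LinearMap.id_apply] at hn
    simp [← TensorProduct.tmul_sum, hn]

/-- The underlying vector space of a restricted module. -/
def restrictEquiv (f : B →ₐ[k] A) (M : KRightMod k A) : (M.restrict f).carrier ≃ₗ[k] M.carrier :=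
  LinearEquiv.refl k M.carrier

theorem restrictEquiv_op_smul (f : B →ₐ[k] A) (M : KRightMod k A) (b : B)
    (m : (M.restrict f).carrier) :
    restrictEquiv f M (MulOpposite.op b • m) = MulOpposite.op (f b) • restrictEquiv f M m := rfl

instance (f : B →ₐ[k] A) (M : KRightMod k A) [Module.Finite k M.carrier] :
    Module.Finite k (M.restrict f).carrier :=
  Module.Finite.equiv (restrictEquiv f M).symm

theorem pairAct_map (f : B →ₐ[k] A) (M N : KRightMod k A) (z : B ⊗[k] B)
    (x : (M.restrict f).carrier ⊗[k] (N.restrict f).carrier) :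
    TensorProduct.congr (restrictEquiv f M) (restrictEquiv f N) (pairAct _ _ z x) =
      pairAct M.carrier N.carrier (Algebra.TensorProduct.map f f z)
        (TensorProduct.congr (restrictEquiv f M) (restrictEquiv f N) x) := by
  induction x with
  | zero => simp
  | add x y hx hy => simp only [map_add, hx, hy]
  | tmul m n =>
    induction z with
    | zero => simp
    | add z w hz hw => simp only [map_add, LinearMap.add_apply, hz, hw]
    | tmul a b => simp [restrictEquiv_op_smul]

/-- Restriction along a homomorphism of bialgebras commutes with tensor products. -/
def restrictTensor (f : B →ₐ[k] A)
    (hf : ∀ b, Coalgebra.comul (R := k) (f b) =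
      Algebra.TensorProduct.map f f (Coalgebra.comul (R := k) b))
    (M N : KRightMod k A) :
    ((M.restrict f).tensor (N.restrict f)).carrier ≃ₗ[Bᵐᵒᵖ] ((M.tensor N).restrict f).carrier :=
  let e : ((M.restrict f).tensor (N.restrict f)).carrier ≃ₗ[k] ((M.tensor N).restrict f).carrier :=
    (tensorEquiv (M.restrict f) (N.restrict f)).trans <|
      (TensorProduct.congr (restrictEquiv f M) (restrictEquiv f N)).trans <|
      (tensorEquiv M N).symm.trans (restrictEquiv f (M.tensor N)).symm
  have he : ∀ (b : B) x, e (MulOpposite.op b • x) = MulOpposite.op b • e x := fun b x => by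
    simp only [e, LinearEquiv.trans_apply, tensorEquiv_op_smul]
    rw [pairAct_map, ← hf, tensorEquiv_symm_pairAct, LinearEquiv.symm_apply_eq,
      restrictEquiv_op_smul, LinearEquiv.apply_symm_apply]
  LinearEquiv.ofBijective (linearMapOfCommute e.toLinearMap he) e.bijective

end Bialgebra

section Hopf

variable {k : Type v} [Field k] {A : Type u} [Ring A] [HopfAlgebra k A]

variable (k A) in
/-- The right regular module. -/
def regular : KRightMod k A where
  carrier := Aᵐᵒᵖ

/-- `M ⊗ A` is free on the elements `bᵢ ⊗ 1`, for `bᵢ` a `k`-basis of `M`. They generate because `m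
⊗ a = ∑ (m S(a₍₁₎) ⊗ 1) a₍₂₎`, and comparing dimensions over `k` gives independence. -/
theorem summandOfMultiple_tensor_regular [FiniteDimensional k A] (M : KRightMod k A)
    [Module.Finite k M.carrier] :
    SummandOfMultiple Aᵐᵒᵖ (M.tensor (regular k A)).carrier Aᵐᵒᵖ := by
  let b := Module.finBasis k M.carrier
  have : Module.Finite k (regular k A).carrier :=
    Module.Finite.equiv (MulOpposite.opLinearEquiv k : A ≃ₗ[k] Aᵐᵒᵖ)
  have : Module.Finite k Aᵐᵒᵖ := this
  let γ : M.carrier →ₗ[k] (M.tensor (regular k A)).carrier :=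
    (tensorEquiv M (regular k A)).symm.toLinearMap ∘ₗ
      (TensorProduct.mk k M.carrier (regular k A).carrier).flip (1 : Aᵐᵒᵖ)
  let G : (Fin (Module.finrank k M.carrier) → Aᵐᵒᵖ) →ₗ[Aᵐᵒᵖ] (M.tensor (regular k A)).carrier :=
    ∑ i, LinearMap.toSpanSingleton Aᵐᵒᵖ _ (γ (b i)) ∘ₗ LinearMap.proj i
  have hγ : ∀ (m : M.carrier) (a : A), MulOpposite.op a • γ m ∈ LinearMap.range G := by
    intro m a
    rw [← b.sum_repr m, map_sum, Finset.smul_sum]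
    refine Submodule.sum_mem _ fun i _ => ?_
    refine Submodule.smul_mem _ _ ?_
    rw [map_smul, ← algebraMap_smul Aᵐᵒᵖ (b.repr m i) (γ (b i))]
    refine Submodule.smul_mem _ _ ⟨Pi.single i 1, ?_⟩
    simp only [G, LinearMap.sum_apply, LinearMap.comp_apply, LinearMap.proj_apply,
      LinearMap.toSpanSingleton_apply]
    rw [Finset.sum_eq_single i (fun j _ hj => by simp [hj]) (by simp)]
    simp
  have hsurj : Function.Surjective G := by
    rw [← LinearMap.range_eq_top, eq_top_iff]
    intro x _
    obtain ⟨x, rfl⟩ := (tensorEquiv M (regular k A)).symm.surjective x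
    induction x with
    | zero => simp
    | add x y hx hy => rw [map_add]; exact Submodule.add_mem _ (hx trivial) (hy trivial)
    | tmul m n =>
      have h := sum_op_smul_antipode_tmul M.carrier (regular k A).carrier
        (Coalgebra.Repr.arbitrary k (MulOpposite.unop n)) m (1 : Aᵐᵒᵖ)
      have hn : (MulOpposite.op (MulOpposite.unop n) • (1 : Aᵐᵒᵖ)) = n :=
        mul_one (show Aᵐᵒᵖ from n)
      have h' : (tensorEquiv M (regular k A)).symm (m ⊗ₜ n) = _ :=
        (congrArg (fun t : (regular k A).carrier =>
          (tensorEquiv M (regular k A)).symm (m ⊗ₜ t)) hn).symm.trans h.symm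
      rw [h']
      exact Submodule.sum_mem _ fun i _ => hγ _ _
  have hdim : Module.finrank k (Fin (Module.finrank k M.carrier) → Aᵐᵒᵖ) =
      Module.finrank k (M.tensor (regular k A)).carrier := by
    rw [(tensorEquiv M (regular k A)).finrank_eq, Module.finrank_tensorProduct,
      Module.finrank_pi_fintype, Finset.sum_const, Finset.card_univ, Fintype.card_fin, smul_eq_mul]
    rfl
  have hinj : Function.Injective G :=
    (LinearMap.injective_iff_surjective_of_finrank_eq_finrank
      (f := G.restrictScalars k) hdim).mpr hsurj
  let e := LinearEquiv.ofBijective G ⟨hinj, hsurj⟩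
  refine (SummandOfMultiple.of_equiv e.symm).trans ⟨_, fun i => LinearMap.proj i,
    fun i => LinearMap.single Aᵐᵒᵖ (fun _ => Aᵐᵒᵖ) i, LinearMap.ext fun x => ?_⟩
  simp only [LinearMap.sum_apply, LinearMap.comp_apply, LinearMap.proj_apply,
    LinearMap.single_apply, LinearMap.id_apply]
  exact Finset.univ_sum_single x

/-- Over a finite-dimensional Hopf algebra, the tensor product of a finite-dimensional module and a
finitely generated projective module is projective. -/
theorem summandOfMultiple_tensor_self [FiniteDimensional k A] (M N : KRightMod k A)
    [Module.Finite k M.carrier] (hN : SummandOfMultiple Aᵐᵒᵖ N.carrier Aᵐᵒᵖ) :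
    SummandOfMultiple Aᵐᵒᵖ (M.tensor N).carrier Aᵐᵒᵖ :=
  (summandOfMultiple_tensor M (N' := regular k A) hN).trans (summandOfMultiple_tensor_regular M)

end Hopf

section Chevalley

variable {k : Type v} [Field k] {A : Type u} [Ring A] [Bialgebra k A]

/-- If `A` has the Chevalley property, then tensor products of semisimple modules are
semisimple. -/
theorem isSemisimpleModule_tensor (hA : ChevalleyProperty k A) (M N : KRightMod k A)
    (hM : IsSemisimpleModule Aᵐᵒᵖ M.carrier) (hN : IsSemisimpleModule Aᵐᵒᵖ N.carrier) :
    IsSemisimpleModule Aᵐᵒᵖ (M.tensor N).carrier := by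
  -- `M ⊗ N` is the sum of the images of `X ⊗ Y` for simple submodules `X` and `Y`, each image being
  -- a quotient of a semisimple module.
  let F : {X : Submodule Aᵐᵒᵖ M.carrier // IsSimpleModule Aᵐᵒᵖ X} ×
      {Y : Submodule Aᵐᵒᵖ N.carrier // IsSimpleModule Aᵐᵒᵖ Y} →
        Submodule Aᵐᵒᵖ (M.tensor N).carrier := fun p => LinearMap.range
    (tensorMap (M := M.ofSubmodule p.1.1) (N := N.ofSubmodule p.2.1) p.1.1.subtype p.2.1.subtype)
  have hF : ∀ p, IsSemisimpleModule Aᵐᵒᵖ (F p) := fun p => by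
    have : IsSemisimpleModule Aᵐᵒᵖ
        ((M.ofSubmodule p.1.1).tensor (N.ofSubmodule p.2.1)).carrier :=
      hA (M.ofSubmodule p.1.1).carrier (N.ofSubmodule p.2.1).carrier p.1.2 p.2.2
    exact IsSemisimpleModule.range _
  refine isSemisimpleModule_of_isSemisimpleModule_submodule' hF (eq_top_iff.mpr fun x _ => ?_)
  obtain ⟨x, rfl⟩ := (tensorEquiv M N).symm.surjective x
  induction x with
  | zero => simp
  | add x y hx hy => rw [map_add]; exact Submodule.add_mem _ (hx trivial) (hy trivial)
  | tmul m n =>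
    have hm : m ∈ sSup {X : Submodule Aᵐᵒᵖ M.carrier | IsSimpleModule Aᵐᵒᵖ X} := by
      rw [IsSemisimpleModule.sSup_simples_eq_top]; trivial
    have hn : n ∈ sSup {X : Submodule Aᵐᵒᵖ N.carrier | IsSimpleModule Aᵐᵒᵖ X} := by
      rw [IsSemisimpleModule.sSup_simples_eq_top]; trivial
    rw [sSup_eq_iSup'] at hm hn
    refine Submodule.iSup_induction _ (motive := fun m => (tensorEquiv M N).symm (m ⊗ₜ n) ∈ iSup F)
      hm (fun X m hm => ?_) (by simp) fun a b ha hb => by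
        rw [TensorProduct.add_tmul, map_add]; exact Submodule.add_mem _ ha hb
    refine Submodule.iSup_induction _ (motive := fun n => (tensorEquiv M N).symm (m ⊗ₜ n) ∈ iSup F)
      hn (fun Y n hn => ?_) (by simp) fun a b ha hb => by
        rw [TensorProduct.tmul_add, map_add]; exact Submodule.add_mem _ ha hb
    refine Submodule.mem_iSup_of_mem (X, Y) ⟨(tensorEquiv _ _).symm
      ((show (M.ofSubmodule X.1).carrier from ⟨m, hm⟩) ⊗ₜ
        (show (N.ofSubmodule Y.1).carrier from ⟨n, hn⟩)), ?_⟩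
    rfl

end Chevalley

end KRightMod

/-! ### Bimodules `M ⊗ N` with diagonal right action. -/

namespace KBimod

section General

variable {k : Type v} [Field k] {A B C D : Type u} [Ring A] [Algebra k A] [Ring B] [Algebra k B]
  [Ring C] [Algebra k C] [Ring D] [Algebra k D]

/-- A `k`-linear map commuting with both actions is a homomorphism of bimodules. -/
def homOfCommute {M N : KBimod k A B} (φ : M.carrier →ₗ[k] N.carrier)
    (hl : ∀ (a : A) m, φ (a • m) = a • φ m)
    (hr : ∀ (b : B) m, φ (MulOpposite.op b • m) = MulOpposite.op b • φ m) :
    M.carrier →ₗ[A ⊗[k] Bᵐᵒᵖ] N.carrier where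
  toFun := φ
  map_add' := φ.map_add
  map_smul' z m := by
    induction z with
    | zero =>
      exact (congrArg φ (zero_smul (A ⊗[k] Bᵐᵒᵖ) m)).trans
        ((map_zero φ).trans (zero_smul (A ⊗[k] Bᵐᵒᵖ) (φ m)).symm)
    | add z w hz hw => simp only [add_smul, map_add, hz, hw]
    | tmul a b =>
      have h₁ : (a ⊗ₜ[k] b) • m = a • b • m := TensorProduct.Algebra.smul_def a b m
      have h₂ : (a ⊗ₜ[k] b) • φ m = a • b • φ m := TensorProduct.Algebra.smul_def a b (φ m)
      rw [h₁, hl, RingHom.id_apply, h₂]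
      exact congrArg (a • ·) (hr b.unop m)

/-- An isomorphism of bimodules. -/
structure Iso (M N : KBimod k A B) where
  toEquiv : M.carrier ≃ₗ[k] N.carrier
  map_left : ∀ (a : A) m, toEquiv (a • m) = a • toEquiv m
  map_right : ∀ (b : B) m, toEquiv (MulOpposite.op b • m) = MulOpposite.op b • toEquiv m

namespace Iso

/-- The composition of two isomorphisms. -/
def trans {M N P : KBimod k A B} (e : Iso M N) (e' : Iso N P) : Iso M P where
  toEquiv := e.toEquiv.trans e'.toEquiv
  map_left a m := by simp [e.map_left, e'.map_left]
  map_right b m := by simp [e.map_right, e'.map_right]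

/-- The inverse of an isomorphism. -/
def symm {M N : KBimod k A B} (e : Iso M N) : Iso N M where
  toEquiv := e.toEquiv.symm
  map_left a m := by simp [LinearEquiv.symm_apply_eq, e.map_left]
  map_right b m := by simp [LinearEquiv.symm_apply_eq, e.map_right]

/-- Restriction of an isomorphism. -/
def restrict (f : C →ₐ[k] A) (g : D →ₐ[k] B) {M N : KBimod k A B} (e : Iso M N) :
    Iso (M.restrict f g) (N.restrict f g) where
  toEquiv := e.toEquiv
  map_left c m := e.map_left (f c) m
  map_right d m := e.map_right (g d) m

theorem summandOfMultiple {M N : KBimod k A B} (e : Iso M N) :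
    SummandOfMultiple (A ⊗[k] Bᵐᵒᵖ) M.carrier N.carrier :=
  .of_retract (homOfCommute e.toEquiv.toLinearMap e.map_left e.map_right)
    (homOfCommute e.symm.toEquiv.toLinearMap e.symm.map_left e.symm.map_right)
    (LinearMap.ext fun x => e.toEquiv.symm_apply_apply x)

end Iso

/-- The underlying vector space of a restricted bimodule. -/
def restrictEquiv (f : C →ₐ[k] A) (g : D →ₐ[k] B) (M : KBimod k A B) :
    (M.restrict f g).carrier ≃ₗ[k] M.carrier :=
  LinearEquiv.refl k M.carrier

theorem restrictEquiv_op_smul (f : C →ₐ[k] A) (g : D →ₐ[k] B) (M : KBimod k A B) (d : D)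
    (m : (M.restrict f g).carrier) :
    restrictEquiv f g M (MulOpposite.op d • m) =
      MulOpposite.op (g d) • restrictEquiv f g M m := rfl

theorem tmul_balanced (M : KBimod k A B) (N : KBimod k B C) (m : M.carrier) (b : B)
    (n : N.carrier) : tmul M N (MulOpposite.op b • m) n = tmul M N m (b • n) :=
  (Submodule.Quotient.eq _).mpr (Submodule.subset_span ⟨m, b, n, rfl⟩)

end General

section Diag

variable {k : Type v} [Field k] {A B : Type u} [Ring A] [Algebra k A] [Ring B] [Bialgebra k B]

/-- The bimodule `M ⊗ N` over `k`, for an `A`-`B`-bimodule `M` and a right `B`-module `N`, with the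
left action on `M` and the diagonal right action. -/
def diag (M : KBimod k A B) (N : KRightMod k B) : KBimod k A B :=
  letI : Module A (RightTensor k M.carrier N.carrier) :=
    inferInstanceAs (Module A (M.carrier ⊗[k] N.carrier))
  have hl : ∀ (a : A) (x : RightTensor k M.carrier N.carrier),
      rightTensorEquiv k _ _ (a • x) = TensorProduct.map (Algebra.lsmul k k M.carrier a)
        LinearMap.id (rightTensorEquiv k _ _ x) := fun a x => by
    obtain ⟨x, rfl⟩ := (rightTensorEquiv k _ _).symm.surjective x
    induction x with
    | zero => simp
    | add x y hx hy => simp only [map_add, smul_add, hx, hy]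
    | tmul m n => rfl
  { carrier := RightTensor k M.carrier N.carrier
    towerLeft := inferInstanceAs (IsScalarTower k A (M.carrier ⊗[k] N.carrier))
    comm := ⟨fun a b x => (rightTensorEquiv k _ _).injective <| by
      rw [← MulOpposite.op_unop b, hl, rightTensorEquiv_op_smul, rightTensorEquiv_op_smul, hl]
      exact pairAct_naturality _ _ (fun b m => smul_comm a (MulOpposite.op b) m)
        (fun _ _ => rfl) _ _⟩ }

/-- The underlying vector space of `M ⊗ N`. -/
def diagEquiv (M : KBimod k A B) (N : KRightMod k B) :
    (M.diag N).carrier ≃ₗ[k] M.carrier ⊗[k] N.carrier :=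
  rightTensorEquiv k M.carrier N.carrier

theorem diagEquiv_op_smul (M : KBimod k A B) (N : KRightMod k B) (b : B)
    (x : (M.diag N).carrier) :
    diagEquiv M N (MulOpposite.op b • x) =
      pairAct M.carrier N.carrier (Coalgebra.comul (R := k) b) (diagEquiv M N x) :=
  rightTensorEquiv_op_smul M.carrier N.carrier b x

theorem diagEquiv_symm_pairAct (M : KBimod k A B) (N : KRightMod k B) (b : B)
    (x : M.carrier ⊗[k] N.carrier) :
    (diagEquiv M N).symm (pairAct M.carrier N.carrier (Coalgebra.comul (R := k) b) x) =
      MulOpposite.op b • (diagEquiv M N).symm x :=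
  rightTensorEquiv_symm_pairAct M.carrier N.carrier b x

theorem smul_diagEquiv_symm_tmul (M : KBimod k A B) (N : KRightMod k B) (a : A) (m : M.carrier)
    (n : N.carrier) :
    a • (diagEquiv M N).symm (m ⊗ₜ n) = (diagEquiv M N).symm ((a • m) ⊗ₜ n) := rfl

/-- An isomorphism `M ≅ M'` induces an isomorphism `M ⊗ N ≅ M' ⊗ N`. -/
def Iso.diag {M M' : KBimod k A B} (e : Iso M M') (N : KRightMod k B) :
    Iso (M.diag N) (M'.diag N) where
  toEquiv := (diagEquiv M N).trans <|
    (TensorProduct.congr e.toEquiv (LinearEquiv.refl k N.carrier)).trans (diagEquiv M' N).symm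
  map_left a x := by
    obtain ⟨x, rfl⟩ := (diagEquiv M N).symm.surjective x
    induction x with
    | zero => simp
    | add x y hx hy => simp only [map_add, smul_add, hx, hy]
    | tmul m n => simp [smul_diagEquiv_symm_tmul, e.map_left]
  map_right b x := by
    simp only [LinearEquiv.trans_apply, diagEquiv_op_smul, ← diagEquiv_symm_pairAct]
    congr 1
    exact pairAct_naturality e.toEquiv.toLinearMap LinearMap.id e.map_right (fun _ _ => rfl) _ _

/-- The linear isomorphism `(M ⊗ N) ⊗ P ≅ M ⊗ (N ⊗ P)`. -/
def diagAssocEquiv (M : KBimod k A B) (N P : KRightMod k B) :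
    ((M.diag N).diag P).carrier ≃ₗ[k] (M.diag (N.tensor P)).carrier :=
  rightTensorAssoc k M.carrier N.carrier P.carrier

/-- The isomorphism `(M ⊗ N) ⊗ P ≅ M ⊗ (N ⊗ P)`. -/
def diagAssoc (M : KBimod k A B) (N P : KRightMod k B) :
    Iso ((M.diag N).diag P) (M.diag (N.tensor P)) where
  toEquiv := diagAssocEquiv M N P
  map_left a x := by
    obtain ⟨x, rfl⟩ := (diagEquiv (M.diag N) P).symm.surjective x
    induction x with
    | zero => simp
    | add x y hx hy => simp only [map_add, smul_add, hx, hy]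
    | tmul x p =>
      obtain ⟨x, rfl⟩ := (diagEquiv M N).symm.surjective x
      induction x with
      | zero => simp
      | add x y hx hy => simp only [map_add, smul_add, TensorProduct.add_tmul, hx, hy]
      | tmul m n => rfl
  map_right b x := rightTensorAssoc_op_smul M.carrier N.carrier P.carrier b x

end Diag

/-- Tensoring with a fixed bimodule preserves direct summands of multiples over a Hopf
subalgebra. -/
theorem summandOfMultiple_diag_restrict {k : Type v} [Field k] {A B H : Type u} [Ring A]
    [Algebra k A] [Ring B] [Bialgebra k B] [Ring H] [Bialgebra k H] (f : B →ₐ[k] H)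
    (hf : ∀ b, Coalgebra.comul (R := k) (f b) =
      Algebra.TensorProduct.map f f (Coalgebra.comul (R := k) b))
    (M : KBimod k A H) {N N' : KRightMod k H}
    (h : SummandOfMultiple Bᵐᵒᵖ (N.restrict f).carrier (N'.restrict f).carrier) :
    SummandOfMultiple (A ⊗[k] Bᵐᵒᵖ) ((M.diag N).restrict (AlgHom.id k A) f).carrier
      ((M.diag N').restrict (AlgHom.id k A) f).carrier := by
  -- The map `φ` is only `B`-linear, but the coproduct of `f b` comes from `B ⊗ B` by `hf`, so `id ⊗
  -- φ` still respects the diagonal action of `B`.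
  have key : ∀ {N N' : KRightMod k H}
      (φ : (N.restrict f).carrier →ₗ[Bᵐᵒᵖ] (N'.restrict f).carrier),
      ∃ Φ : ((M.diag N).restrict (AlgHom.id k A) f).carrier →ₗ[A ⊗[k] Bᵐᵒᵖ]
        ((M.diag N').restrict (AlgHom.id k A) f).carrier,
      ∀ m n, Φ ((restrictEquiv _ f _).symm ((diagEquiv M N).symm (m ⊗ₜ n))) =
        (restrictEquiv _ f _).symm ((diagEquiv M N').symm
          (m ⊗ₜ N'.restrictEquiv f (φ ((N.restrictEquiv f).symm n)))) := by
    intro N N' φ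
    let φ' : N.carrier →ₗ[k] N'.carrier := (N'.restrictEquiv f).toLinearMap ∘ₗ
      φ.restrictScalars k ∘ₗ (N.restrictEquiv f).symm.toLinearMap
    have hφ' : ∀ (b : B) n, φ' (MulOpposite.op (f b) • n) = MulOpposite.op (f b) • φ' n :=
      fun b n => φ.map_smul (MulOpposite.op b) _
    have hz : ∀ (z : B ⊗[k] B) (x : M.carrier ⊗[k] N.carrier),
        TensorProduct.map LinearMap.id φ'
          (pairAct M.carrier N.carrier (Algebra.TensorProduct.map f f z) x) =
        pairAct M.carrier N'.carrier (Algebra.TensorProduct.map f f z)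
          (TensorProduct.map LinearMap.id φ' x) := by
      intro z x
      induction x with
      | zero => simp
      | add x y hx hy => simp only [map_add, hx, hy]
      | tmul m n =>
        induction z with
        | zero => simp
        | add z w hz hw => simp only [map_add, LinearMap.add_apply, hz, hw]
        | tmul a b => simp [hφ']
    refine ⟨homOfCommute ((restrictEquiv _ f _).symm.toLinearMap ∘ₗ
      (diagEquiv M N').symm.toLinearMap ∘ₗ TensorProduct.map LinearMap.id φ' ∘ₗ
      (diagEquiv M N).toLinearMap ∘ₗ (restrictEquiv _ f _).toLinearMap) ?_ ?_, fun m n => rfl⟩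
    · intro a x
      obtain ⟨x, rfl⟩ := (restrictEquiv (AlgHom.id k A) f (M.diag N)).symm.surjective x
      obtain ⟨x, rfl⟩ := (diagEquiv M N).symm.surjective x
      induction x with
      | zero => simp
      | add x y hx hy => simp only [map_add, smul_add, hx, hy]
      | tmul m n => rfl
    · intro b x
      simp only [LinearMap.comp_apply, LinearEquiv.coe_coe, restrictEquiv_op_smul,
        diagEquiv_op_smul, hf, hz]
      rw [← hf, diagEquiv_symm_pairAct, LinearEquiv.symm_apply_eq, restrictEquiv_op_smul,
        LinearEquiv.apply_symm_apply]
  obtain ⟨q, φ, ψ, hq⟩ := h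
  choose Φ hΦ using fun i => key (φ i)
  choose Ψ hΨ using fun i => key (ψ i)
  refine ⟨q, Φ, Ψ, LinearMap.ext fun x => ?_⟩
  obtain ⟨x, rfl⟩ := (restrictEquiv (AlgHom.id k A) f (M.diag N)).symm.surjective x
  obtain ⟨x, rfl⟩ := (diagEquiv M N).symm.surjective x
  induction x with
  | zero => simp
  | add x y hx hy => simp only [map_add, hx, hy]
  | tmul m n =>
    have hn := congrArg (N.restrictEquiv f)
      (LinearMap.congr_fun hq ((N.restrictEquiv f).symm n))
    simp only [LinearMap.sum_apply, LinearMap.comp_apply, map_sum, LinearMap.id_apply,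
      LinearEquiv.apply_symm_apply] at hn
    simp only [LinearMap.sum_apply, LinearMap.comp_apply, hΦ, hΨ, LinearEquiv.symm_apply_apply,
      ← map_sum, ← TensorProduct.tmul_sum, hn, LinearMap.id_apply]

end KBimod

open Coalgebra HopfAlgebra

/-! ### The module `V = H / R⁺ H` and the isomorphism `M ⊗_R H ≅ M ⊗ V`. -/

namespace HopfSubalgebra

variable {k : Type v} {H : Type u} [Field k] [Ring H] [HopfAlgebra k H] (R : HopfSubalgebra k H)

instance : Module k R.PermModule := inferInstanceAs (Module k (H ⧸ R.augIdeal))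

instance : IsScalarTower k Hᵐᵒᵖ R.PermModule :=
  inferInstanceAs (IsScalarTower k Hᵐᵒᵖ (H ⧸ R.augIdeal))

theorem comul_val (r : R.Carrier) :
    comul (R := k) (R.toSubalgebra.val r) =
      Algebra.TensorProduct.map R.toSubalgebra.val R.toSubalgebra.val (comul (R := k) r) :=
  (R.inclTensor_comul r).symm

/-- The quotient map `H → V`. -/
def permMk : H →ₗ[k] R.PermModule := R.augIdeal.mkQ.restrictScalars k

theorem permMk_surjective : Function.Surjective R.permMk := R.augIdeal.mkQ_surjective

theorem op_smul_permMk (a h : H) : MulOpposite.op a • R.permMk h = R.permMk (h * a) := rfl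

/-- The element `r - ε(r) 1` lies in `R⁺`. -/
theorem permMk_mul (r : R.Carrier) (h : H) :
    R.permMk (r * h) = counit (R := k) r • R.permMk h := by
  rw [← map_smul]
  refine (Submodule.Quotient.eq R.augIdeal).mpr ?_
  have hr : (r : H) - algebraMap k H (counit (R := k) r) ∈ R.augIdeal := by
    refine Submodule.subset_span ⟨R.toSubalgebra.sub_mem r.2 (R.toSubalgebra.algebraMap_mem _), ?_⟩
    rw [map_sub, Bialgebra.counit_algebraMap, coe_counit, sub_self]
  have := R.augIdeal.smul_mem (MulOpposite.op h) hr
  rwa [op_smul_eq_mul, sub_mul, ← Algebra.smul_def] at this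

theorem eq_zero_of_mem_augIdeal {X : Type*} [AddCommGroup X] [Module k X] (f : H →ₗ[k] X)
    (hf : ∀ (r : R.Carrier) h, f (r * h) = counit (R := k) r • f h) {x : H}
    (hx : x ∈ R.augIdeal) : f x = 0 := by
  -- The map `f` is not `H`-linear, so the induction over the right ideal needs an arbitrary right
  -- factor `y`.
  suffices h : ∀ y, f (x * y) = 0 by simpa using h 1
  induction hx using Submodule.span_induction with
  | mem x hx =>
    intro y
    rw [hf ⟨x, hx.1⟩ y, coe_counit, hx.2, zero_smul]
  | zero => simp
  | add x x' _ _ h h' => intro y; rw [add_mul, map_add, h, h', add_zero]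
  | smul a x _ h => intro y; rw [← MulOpposite.op_unop a, op_smul_eq_mul, mul_assoc, h]

/-- The universal property of `V = H / R⁺ H`. -/
def permLift {X : Type*} [AddCommGroup X] [Module k X] (f : H →ₗ[k] X)
    (hf : ∀ (r : R.Carrier) h, f (r * h) = counit (R := k) r • f h) : R.PermModule →ₗ[k] X :=
  (R.augIdeal.restrictScalars k).liftQ f fun _ hx => R.eq_zero_of_mem_augIdeal f hf hx

/-- `V` as a bundled right module. -/
def permMod : KRightMod k H where
  carrier := R.PermModule

/-- The counit of `V`. -/
def permCounit : R.permMod.carrier →ₗ[k] k :=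
  R.permLift (counit (R := k)) fun r h => by rw [Bialgebra.counit_mul, coe_counit, smul_eq_mul]

theorem permCounit_permMk (h : H) : R.permCounit (R.permMk h) = counit (R := k) h := rfl

theorem permCounit_op_smul (a : H) (x : R.permMod.carrier) :
    R.permCounit (MulOpposite.op a • x) = counit (R := k) a * R.permCounit x := by
  obtain ⟨h, rfl⟩ := R.permMk_surjective x
  refine (R.permCounit_permMk (h * a)).trans ?_
  rw [Bialgebra.counit_mul, mul_comm]
  rfl

/-- The class of `1` in `V`. -/
def permOne : R.permMod.carrier := R.permMk 1

theorem op_smul_permOne (h : H) : MulOpposite.op h • R.permOne = R.permMk h := by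
  refine (R.op_smul_permMk h 1).trans ?_
  rw [one_mul]

/-- Triviality of the line through `1̄` over `R` is what makes `m ↦ m ⊗ 1̄` an `R`-linear map. -/
theorem op_smul_permOne_of_mem (r : R.Carrier) :
    MulOpposite.op (r : H) • R.permOne = counit (R := k) r • R.permOne := by
  rw [op_smul_permOne]
  have := R.permMk_mul r 1
  rwa [mul_one] at this

instance [FiniteDimensional k H] : Module.Finite k R.permMod.carrier :=
  Module.Finite.of_surjective R.permMk R.permMk_surjective

/-- `(m ⊗ 1̄) r = m r ⊗ 1̄` for `r ∈ R`. -/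
theorem pairAct_comul_tmul_permOne (M : Type*) [AddCommGroup M] [Module k M] [Module Hᵐᵒᵖ M]
    [IsScalarTower k Hᵐᵒᵖ M] (r : R.Carrier) (m : M) :
    pairAct M R.permMod.carrier (comul (R := k) (r : H)) (m ⊗ₜ R.permOne) =
      (MulOpposite.op (r : H) • m) ⊗ₜ R.permOne := by
  -- Since the coproduct of `r` lies in `R ⊗ R`, its second leg acts on `1̄` by the counit, leaving
  -- `∑ m r₍₁₎ ε(r₍₂₎) ⊗ 1̄`.
  have h : ∀ z : R.Carrier ⊗[k] R.Carrier,
      pairAct M R.permMod.carrier (R.inclTensor z) (m ⊗ₜ R.permOne) =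
        rightMul (k := k) M (TensorProduct.rid k H (TensorProduct.map R.toSubalgebra.val.toLinearMap
          (counit (R := k) (A := R.Carrier)) z)) m ⊗ₜ[k] R.permOne := by
    intro z
    induction z with
    | zero => simp
    | add z w hz hw => simp only [map_add, LinearMap.add_apply, TensorProduct.add_tmul, hz, hw]
    | tmul p q =>
      have hq := R.op_smul_permOne_of_mem q
      simp only [inclTensor, Algebra.TensorProduct.map_tmul, pairAct_tmul,
        Subalgebra.coe_val, TensorProduct.map_tmul, TensorProduct.rid_tmul, map_smul,
        LinearMap.smul_apply, rightMul_apply, AlgHom.toLinearMap_apply, hq]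
      rw [TensorProduct.tmul_smul, TensorProduct.smul_tmul']
  rw [← R.inclTensor_comul, h]
  congr 1
  have h₁ : TensorProduct.map R.toSubalgebra.val.toLinearMap (counit (R := k) (A := R.Carrier))
      (comul (R := k) r) = (r : H) ⊗ₜ 1 := by
    have := congrArg (R.toSubalgebra.val.toLinearMap.rTensor k)
      (lTensor_counit_comul (R := k) r)
    rw [← LinearMap.comp_apply, LinearMap.rTensor_comp_lTensor] at this
    simpa using this
  rw [h₁]
  simp [rightMul_apply]

section TensorProduct

variable {A : Type u} [Ring A] [Algebra k A] (M : KBimod k A H)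

/-- The bimodule `M ⊗_R H`. -/
abbrev induced : KBimod k A H :=
  (M.restrict (AlgHom.id k A) R.toSubalgebra.val).tensor
    ((KBimod.regular k H).restrict R.toSubalgebra.val (AlgHom.id k H))

/-- The bilinear map `M × H → M ⊗_R H`. -/
def inducedMk : M.carrier →ₗ[k] H →ₗ[k] (R.induced M).carrier :=
  LinearMap.mk₂ k (fun m h => KBimod.tmul (M.restrict (AlgHom.id k A) R.toSubalgebra.val)
      ((KBimod.regular k H).restrict R.toSubalgebra.val (AlgHom.id k H)) m h)
    (fun m m' h => KBimod.add_tmul (M.restrict (AlgHom.id k A) R.toSubalgebra.val)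
      ((KBimod.regular k H).restrict R.toSubalgebra.val (AlgHom.id k H)) m m' h)
    (fun t m h => KBimod.smul_tmul (M.restrict (AlgHom.id k A) R.toSubalgebra.val)
      ((KBimod.regular k H).restrict R.toSubalgebra.val (AlgHom.id k H)) t m h)
    (fun m h h' => KBimod.tmul_add (M.restrict (AlgHom.id k A) R.toSubalgebra.val)
      ((KBimod.regular k H).restrict R.toSubalgebra.val (AlgHom.id k H)) m h h')
    (fun t m h => KBimod.tmul_smul (M.restrict (AlgHom.id k A) R.toSubalgebra.val)
      ((KBimod.regular k H).restrict R.toSubalgebra.val (AlgHom.id k H)) t m h)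

theorem inducedMk_balanced (m : M.carrier) (r : R.Carrier) (h : H) :
    R.inducedMk M (MulOpposite.op (r : H) • m) h = R.inducedMk M m (r * h) :=
  KBimod.tmul_balanced (M.restrict (AlgHom.id k A) R.toSubalgebra.val)
    ((KBimod.regular k H).restrict R.toSubalgebra.val (AlgHom.id k H)) m r h

theorem smul_inducedMk (a : A) (m : M.carrier) (h : H) :
    a • R.inducedMk M m h = R.inducedMk M (a • m) h := rfl

theorem op_smul_inducedMk (m : M.carrier) (h h' : H) :
    MulOpposite.op h' • R.inducedMk M m h = R.inducedMk M m (h * h') := rfl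

theorem induced_induction {p : (R.induced M).carrier → Prop}
    (hmk : ∀ m h, p (R.inducedMk M m h)) (hadd : ∀ x y, p x → p y → p (x + y))
    (x : (R.induced M).carrier) : p x := by
  obtain ⟨z, rfl⟩ := Submodule.mkQ_surjective (KBimod.balancingRelations
    (M.restrict (AlgHom.id k A) R.toSubalgebra.val)
    ((KBimod.regular k H).restrict R.toSubalgebra.val (AlgHom.id k H))) x
  induction z with
  | zero =>
    have := hmk 0 0
    rwa [map_zero] at this
  | add z w hz hw => exact hadd _ _ hz hw
  | tmul m h => exact hmk m h

/-- The universal property of `M ⊗_R H`. -/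
def inducedLift {X : Type*} [AddCommGroup X] [Module k X] (f : M.carrier →ₗ[k] H →ₗ[k] X)
    (hf : ∀ m (r : R.Carrier) h, f (MulOpposite.op (r : H) • m) h = f m (r * h)) :
    (R.induced M).carrier →ₗ[k] X :=
  (KBimod.balancingRelations (M.restrict (AlgHom.id k A) R.toSubalgebra.val)
    ((KBimod.regular k H).restrict R.toSubalgebra.val (AlgHom.id k H))).liftQ
      (TensorProduct.lift f ∘ₗ (TensorProduct.congr (KBimod.restrictEquiv _ _ M)
        (KBimod.restrictEquiv R.toSubalgebra.val (AlgHom.id k H)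
          (KBimod.regular k H))).toLinearMap) <| by
    refine Submodule.span_le.mpr ?_
    rintro _ ⟨m, r, h, rfl⟩
    rw [SetLike.mem_coe, LinearMap.mem_ker, map_sub, sub_eq_zero]
    exact hf m r h

/-- The map `a ⊗ b ↦ (m ↦ m a ⊗ b)`. -/
def inducedPair : H ⊗[k] H →ₗ[k] M.carrier →ₗ[k] (R.induced M).carrier :=
  TensorProduct.lift <| LinearMap.mk₂ k (fun a b => (R.inducedMk M).flip b ∘ₗ rightMul M.carrier a)
    (fun a a' b => by ext m; simp) (fun t a b => by ext m; simp)
    (fun a b b' => by ext m; simp) (fun t a b => by ext m; simp)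

theorem inducedPair_tmul (a b : H) (m : M.carrier) :
    R.inducedPair M (a ⊗ₜ b) m = R.inducedMk M (MulOpposite.op a • m) b := rfl

theorem inducedPair_tmul_one_mul (a : H) (z : H ⊗[k] H) (m : M.carrier) :
    R.inducedPair M ((a ⊗ₜ 1) * z) m = R.inducedPair M z (MulOpposite.op a • m) := by
  induction z with
  | zero => simp
  | add z w hz hw => simp only [mul_add, map_add, LinearMap.add_apply, hz, hw]
  | tmul p q => simp [inducedPair_tmul, mul_smul]

/-- Needed for `m ⊗ h̄ ↦ ∑ m S(h₍₁₎) ⊗ h₍₂₎` to be well defined on `V`. Replacing `h` by `r h` gives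
`∑ m S(h₍₁₎) S(r₍₁₎) ⊗ r₍₂₎ h₍₂₎`; as `r₍₂₎ ∈ R` it crosses the tensor sign, and `∑ S(r₍₁₎) r₍₂₎ =
ε(r)`. -/
theorem inducedPair_antipode_comul_mul (r : R.Carrier) (h : H) :
    R.inducedPair M ((antipode k).rTensor H (comul (R := k) (r * h : H))) =
      counit (R := k) r • R.inducedPair M ((antipode k).rTensor H (comul (R := k) h)) := by
  have key : ∀ (y : R.Carrier ⊗[k] R.Carrier) (z : H ⊗[k] H),
      R.inducedPair M ((antipode k).rTensor H (R.inclTensor y * z)) =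
        R.inducedPair M ((antipode k).rTensor H z *
          (LinearMap.mul' k H ((antipode k).rTensor H (R.inclTensor y)) ⊗ₜ 1)) := by
    intro y z
    induction y with
    | zero => simp
    | add y w hy hw => simp only [map_add, add_mul, TensorProduct.add_tmul, mul_add, hy, hw]
    | tmul p q =>
      induction z with
      | zero => simp
      | add y w hy hw => simp only [map_add, add_mul, mul_add, hy, hw]
      | tmul a b =>
        ext m
        have hq := R.inducedMk_balanced M
          (MulOpposite.op (antipode k (p : H)) • MulOpposite.op (antipode k a) • m) q b
        simp only [inclTensor, Algebra.TensorProduct.map_tmul, Algebra.TensorProduct.tmul_mul_tmul,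
          LinearMap.rTensor_tmul, inducedPair_tmul, antipode_mul_antidistrib, mul_one,
          LinearMap.mul'_apply, MulOpposite.op_mul, mul_smul, Subalgebra.coe_val]
        exact hq.symm
  rw [Bialgebra.comul_mul, ← R.inclTensor_comul, key, R.inclTensor_comul,
    mul_antipode_rTensor_comul_apply, coe_counit, ← map_smul, Algebra.algebraMap_eq_smul_one,
    ← TensorProduct.smul_tmul', mul_smul_comm, ← Algebra.TensorProduct.one_def, mul_one]

/-- The isomorphism `M ⊗_R H ≅ M ⊗ V`, `m ⊗ h ↦ (m ⊗ 1̄) h`. -/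
def inducedIso : KBimod.Iso (R.induced M) (M.diag R.permMod) :=
  let ι : M.carrier →ₗ[k] (M.diag R.permMod).carrier :=
    (KBimod.diagEquiv M R.permMod).symm.toLinearMap ∘ₗ
      (TensorProduct.mk k M.carrier R.permMod.carrier).flip R.permOne
  let F : (R.induced M).carrier →ₗ[k] (M.diag R.permMod).carrier :=
    R.inducedLift M ((rightMul (k := k) (A := H) (M.diag R.permMod).carrier).flip ∘ₗ ι)
      fun m r h => by
        simp only [LinearMap.comp_apply, LinearMap.flip_apply, rightMul_apply, MulOpposite.op_mul,
          mul_smul]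
        congr 1
        refine Eq.trans ?_ (KBimod.diagEquiv_symm_pairAct M R.permMod (r : H) (m ⊗ₜ R.permOne))
        rw [R.pairAct_comul_tmul_permOne]
        rfl
  -- The inverse is `m ⊗ h̄ ↦ ∑ m S(h₍₁₎) ⊗ h₍₂₎`. Then `G ∘ F` sends `m ⊗ h` to `∑ m h₍₁₎ S(h₍₂₎) ⊗
  -- h₍₃₎`, and `F ∘ G` sends `m ⊗ h̄` to `∑ (m S(h₍₁₎) ⊗ 1̄) h₍₂₎`; both collapse by the antipode
  -- identities.
  let G : (M.diag R.permMod).carrier →ₗ[k] (R.induced M).carrier :=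
    TensorProduct.lift (R.permLift (R.inducedPair M ∘ₗ (antipode k).rTensor H ∘ₗ comul)
      (R.inducedPair_antipode_comul_mul M)).flip ∘ₗ (KBimod.diagEquiv M R.permMod).toLinearMap
  have hF : ∀ m h, F (R.inducedMk M m h) = MulOpposite.op h • ι m := fun _ _ => rfl
  have hG : ∀ m h, G ((KBimod.diagEquiv M R.permMod).symm (m ⊗ₜ R.permMk h)) =
    R.inducedPair M ((antipode k).rTensor H (comul (R := k) h)) m := fun _ _ => rfl
  have hGF : G ∘ₗ F = LinearMap.id := LinearMap.ext fun x => by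
    induction x using R.induced_induction M with
    | hadd x y hx hy => rw [map_add, map_add, hx, hy]
    | hmk m h =>
      let r := Repr.arbitrary k h
      have h₁ : MulOpposite.op h • ι m = ∑ i ∈ r.index, (KBimod.diagEquiv M R.permMod).symm
          ((MulOpposite.op (r.left i) • m) ⊗ₜ R.permMk (r.right i)) := by
        rw [← map_sum]
        refine (KBimod.diagEquiv_symm_pairAct M R.permMod h (m ⊗ₜ R.permOne)).symm.trans ?_
        rw [← r.eq, map_sum, LinearMap.sum_apply]
        congr 1
        refine Finset.sum_congr rfl fun i _ => ?_
        rw [pairAct_tmul, op_smul_permOne]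
      rw [LinearMap.comp_apply, hF, h₁, map_sum]
      simp only [hG, ← inducedPair_tmul_one_mul]
      rw [← LinearMap.sum_apply, ← map_sum, sum_tmul_one_mul_antipode_comul r, inducedPair_tmul,
        MulOpposite.op_one, one_smul, LinearMap.id_apply]
  have hFG : F ∘ₗ G = LinearMap.id := LinearMap.ext fun x => by
    obtain ⟨x, rfl⟩ := (KBimod.diagEquiv M R.permMod).symm.surjective x
    induction x with
    | zero => simp
    | add x y hx hy => rw [map_add, map_add, map_add, hx, hy]
    | tmul m x =>
      obtain ⟨h, rfl⟩ := R.permMk_surjective x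
      let r := Repr.arbitrary k h
      rw [LinearMap.comp_apply, hG, ← r.eq]
      simp only [map_sum, LinearMap.sum_apply, LinearMap.rTensor_tmul, inducedPair_tmul, hF,
        LinearMap.id_apply]
      refine (sum_op_smul_antipode_tmul M.carrier R.permMod.carrier r m R.permOne).trans ?_
      rw [op_smul_permOne]
      rfl
  { toEquiv := LinearEquiv.ofLinearMap F G hFG hGF
    map_left := fun a x => by
      change F (a • x) = a • F x
      induction x using R.induced_induction M with
      | hadd x y hx hy => rw [smul_add, map_add, map_add, smul_add, hx, hy]
      | hmk m h =>
        rw [smul_inducedMk, hF, hF, smul_comm]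
        rfl
    map_right := fun b x => by
      change F (MulOpposite.op b • x) = MulOpposite.op b • F x
      induction x using R.induced_induction M with
      | hadd x y hx hy => rw [smul_add, map_add, map_add, smul_add, hx, hy]
      | hmk m h => rw [op_smul_inducedMk, hF, hF, MulOpposite.op_mul, mul_smul] }

end TensorProduct

/-! ### Tensor powers of `V` and the reduction of depth to them. -/

/-- The tensor power `V ⊗ ⋯ ⊗ V` with `n + 1` factors. -/
def permPow : ℕ → KRightMod k H
  | 0 => R.permMod
  | n + 1 => (permPow n).tensor R.permMod

instance [FiniteDimensional k H] (n : ℕ) : Module.Finite k (R.permPow n).carrier := by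
  induction n with
  | zero => exact inferInstanceAs (Module.Finite k R.permMod.carrier)
  | succ n ih => exact inferInstanceAs (Module.Finite k ((R.permPow n).tensor R.permMod).carrier)

/-- `H ⊗_R ⋯ ⊗_R H ≅ H ⊗ V ⊗ ⋯ ⊗ V` as `H`-`H`-bimodules. -/
def tensorPowIso : (n : ℕ) → KBimod.Iso (tensorPow R.toSubalgebra (n + 1))
    ((KBimod.regular k H).diag (R.permPow n))
  -- Both families start at one factor, so `n + 2` factors `H` correspond to `n + 1` factors `V`.
  | 0 => R.inducedIso (KBimod.regular k H)
  | n + 1 => (R.inducedIso (tensorPow R.toSubalgebra (n + 1))).trans <|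
      ((tensorPowIso n).diag R.permMod).trans (KBimod.diagAssoc _ (R.permPow n) R.permMod)

/-- The projection `M ⊗ V → M` given by the counit of `V`. -/
def tensorPermProj (M : KRightMod k H) : (M.tensor R.permMod).carrier →ₗ[Hᵐᵒᵖ] M.carrier :=
  linearMapOfCommute ((TensorProduct.rid k M.carrier).toLinearMap ∘ₗ R.permCounit.lTensor _ ∘ₗ
    (KRightMod.tensorEquiv M R.permMod).toLinearMap) fun a x => by
    have key : ∀ (z : H ⊗[k] H) (m : M.carrier) (v : R.permMod.carrier),
        TensorProduct.rid k _ (R.permCounit.lTensor _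
          (pairAct M.carrier R.permMod.carrier z (m ⊗ₜ v))) =
        R.permCounit v • rightMul (k := k) M.carrier (TensorProduct.rid k H
          ((counit (R := k) (A := H)).lTensor H z)) m := by
      intro z m v
      induction z with
      | zero => simp
      | add z w hz hw => simp only [map_add, LinearMap.add_apply, hz, hw, smul_add]
      | tmul p q => simp [rightMul_apply, permCounit_op_smul, mul_comm _ (R.permCounit v), mul_smul]
    obtain ⟨x, rfl⟩ := (KRightMod.tensorEquiv M R.permMod).symm.surjective x
    simp only [LinearMap.comp_apply, LinearEquiv.coe_coe, KRightMod.tensorEquiv_op_smul,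
      LinearEquiv.apply_symm_apply]
    induction x with
    | zero => simp
    | add x y hx hy => simp only [map_add, smul_add, hx, hy]
    | tmul m v =>
      rw [key, lTensor_counit_comul, TensorProduct.rid_tmul, one_smul, rightMul_apply,
        LinearMap.lTensor_tmul, TensorProduct.rid_tmul]
      exact smul_comm _ _ _

/-- The projection from a tensor power of `V` to the previous one. -/
def permPowProj (n : ℕ) : (R.permPow (n + 1)).carrier →ₗ[Hᵐᵒᵖ] (R.permPow n).carrier :=
  R.tensorPermProj (R.permPow n)

theorem permPowProj_tmul (n : ℕ) (m : (R.permPow n).carrier) (v : R.permMod.carrier) :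
    R.permPowProj n ((KRightMod.tensorEquiv (R.permPow n) R.permMod).symm (m ⊗ₜ v)) =
      R.permCounit v • m := rfl

theorem permCounit_permOne : R.permCounit R.permOne = 1 :=
  (R.permCounit_permMk 1).trans Bialgebra.counit_one

theorem permPowProj_surjective (n : ℕ) : Function.Surjective (R.permPowProj n) := fun m =>
  ⟨(KRightMod.tensorEquiv (R.permPow n) R.permMod).symm (m ⊗ₜ R.permOne), by
    rw [permPowProj_tmul, permCounit_permOne, one_smul]⟩

/-- The tensor powers of `V` as right `R`-modules. -/
abbrev permPowRes (n : ℕ) : KRightMod k R.Carrier := (R.permPow n).restrict R.toSubalgebra.val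

/-- The map `m ↦ m ⊗ 1̄` is `R`-linear and split by the counit of `V`. One half of the similarity
thus holds for every `n`. -/
theorem summandOfMultiple_permPowRes_succ (n : ℕ) :
    SummandOfMultiple R.Carrierᵐᵒᵖ (R.permPowRes n).carrier (R.permPowRes (n + 1)).carrier := by
  let ι : (R.permPow n).carrier →ₗ[k] ((R.permPow n).tensor R.permMod).carrier :=
    (KRightMod.tensorEquiv (R.permPow n) R.permMod).symm.toLinearMap ∘ₗ
      (TensorProduct.mk k (R.permPow n).carrier R.permMod.carrier).flip R.permOne
  have hι : ∀ (r : R.Carrier) m,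
      ι (MulOpposite.op (r : H) • m) = MulOpposite.op (r : H) • ι m := fun r m => by
    refine Eq.trans ?_ (KRightMod.tensorEquiv_symm_pairAct (R.permPow n) R.permMod (r : H)
      (m ⊗ₜ R.permOne))
    rw [R.pairAct_comul_tmul_permOne]
    rfl
  let ι' : (R.permPowRes n).carrier →ₗ[k] (R.permPowRes (n + 1)).carrier :=
    (KRightMod.restrictEquiv R.toSubalgebra.val (R.permPow (n + 1))).symm.toLinearMap ∘ₗ ι ∘ₗ
      (KRightMod.restrictEquiv R.toSubalgebra.val (R.permPow n)).toLinearMap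
  refine .of_retract (linearMapOfCommute ι' hι)
    (KRightMod.restrictMap R.toSubalgebra.val (R.permPowProj n)) (LinearMap.ext fun m => ?_)
  have h : ∀ m : (R.permPow n).carrier, R.permPowProj n (ι m) = m := fun m => by
    refine (R.permPowProj_tmul n m R.permOne).trans ?_
    rw [permCounit_permOne, one_smul]
  exact h m

/-- If, over `R`, some tensor power of `V` is a direct summand of a multiple of the previous one,
then the depth is finite. -/
theorem minDepth_lt_top {n : ℕ}
    (h : SummandOfMultiple R.Carrierᵐᵒᵖ (R.permPowRes (n + 1)).carrier (R.permPowRes n).carrier) :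
    minDepth R.toSubalgebra < ⊤ := by
  -- The powers of `V` with `n + 2` and `n + 1` factors correspond to those of `H` with `n + 3` and
  -- `n + 2` factors, which gives right depth `2 (n + 2)`.
  have hdepth : HasRightDepth R.toSubalgebra (n + 1) := by
    have e := fun m => (R.tensorPowIso m).restrict (AlgHom.id k H) R.toSubalgebra.val
    have key : ∀ {i j : ℕ},
        SummandOfMultiple R.Carrierᵐᵒᵖ (R.permPowRes i).carrier (R.permPowRes j).carrier →
        SummandOfMultiple (H ⊗[k] R.Carrierᵐᵒᵖ)
          ((tensorPow R.toSubalgebra (i + 1)).restrict (AlgHom.id k H)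
            R.toSubalgebra.val).carrier
          ((tensorPow R.toSubalgebra (j + 1)).restrict (AlgHom.id k H)
            R.toSubalgebra.val).carrier := fun {i j} hij =>
      (e i).summandOfMultiple.trans ((KBimod.summandOfMultiple_diag_restrict R.toSubalgebra.val
        R.comul_val (KBimod.regular k H) hij).trans (e j).symm.summandOfMultiple)
    exact ⟨(key h).dividesMultiple,
      (key (R.summandOfMultiple_permPowRes_succ n)).dividesMultiple⟩
  have hmem : ((2 * (n + 1 + 1) : ℕ) : ℕ∞) ∈ {d : ℕ∞ | ∃ m : ℕ, d = m ∧
      HasDepth R.toSubalgebra m} := ⟨_, rfl, Or.inr ⟨n + 1, rfl, Or.inr hdepth⟩⟩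
  exact (sInf_le hmem).trans_lt (ENat.natCast_lt_top _)

end HopfSubalgebra

/-! ### Pointed duals and the Chevalley property. -/

section Pointed

theorem exists_generator_of_finrank_eq_one {k : Type*} [Field k] {C : Type*} [AddCommGroup C]
    [Module k C] (D : Submodule k C) (h : Module.finrank k D = 1) :
    ∃ v : D, v ≠ 0 ∧ ∀ w : D, ∃ c : k, c • v = w :=
  finrank_eq_one_iff'.mp h

theorem exists_simpleSubcoalgebra_le {k : Type v} [Field k] {C : Type u} [AddCommGroup C]
    [Module k C] [Coalgebra k C] [FiniteDimensional k C] (E : Submodule k C) (hE : IsSubcoalgebra E) (hne : E ≠ ⊥) :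
    ∃ D ≤ E, IsSimpleSubcoalgebra D := by
  obtain ⟨D, ⟨hD, hD0, hDE⟩, hmin⟩ := WellFounded.has_min
    (wellFounded_lt (α := Submodule k C))
    {D | IsSubcoalgebra D ∧ D ≠ ⊥ ∧ D ≤ E} ⟨E, hE, hne, le_rfl⟩
  refine ⟨D, hDE, hD, hD0, fun F hF hFD => or_iff_not_imp_left.mpr fun hF0 => ?_⟩
  by_contra hne'
  exact hmin F ⟨hF, hF0, hFD.trans hDE⟩ (lt_of_le_of_ne hFD hne')

variable {k : Type v} [Field k] {A : Type u} [Ring A] [Algebra k A] [FiniteDimensional k A]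

/-- The annihilator in `A*` of a two-sided ideal of `A` is a subcoalgebra. -/
theorem isSubcoalgebra_dualAnnihilator (I : Submodule k A) (hl : ∀ a, ∀ b ∈ I, a * b ∈ I)
    (hr : ∀ a ∈ I, ∀ b, a * b ∈ I) :
    letI := dualCoalgebra k A
    IsSubcoalgebra I.dualAnnihilator := by
  intro f hf
  have hf' : ∀ x ∈ I, f x = 0 := fun x hx => (Submodule.mem_dualAnnihilator f).mp hf x hx
  -- The form `(a, b) ↦ f (a * b)` descends to `A ⧸ I` in both variables, so it comes from a tensor
  -- over the dual of `A ⧸ I`, which is the annihilator of `I`. The second descent exchanges the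
  -- variables, whence the flip in `g`.
  let b₀ : A →ₗ[k] A →ₗ[k] k := (LinearMap.mul k A).compr₂ f
  let b₁ : (A ⧸ I) →ₗ[k] A →ₗ[k] k := I.liftQ b₀ fun a ha => LinearMap.ext fun b =>
    hf' _ (hr a ha b)
  let b₂ : (A ⧸ I) →ₗ[k] (A ⧸ I) →ₗ[k] k := I.liftQ b₁.flip fun b hb =>
    LinearMap.ext fun x => by
      obtain ⟨a, rfl⟩ := I.mkQ_surjective x
      exact hf' _ (hl a b hb)
  let g : Module.Dual k ((A ⧸ I) ⊗[k] (A ⧸ I)) := TensorProduct.lift b₂.flip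
  have hg : ∀ a b, g (I.mkQ a ⊗ₜ I.mkQ b) = f (a * b) := fun a b => rfl
  let w := (TensorProduct.dualDistribEquiv k (A ⧸ I) (A ⧸ I)).symm g
  have hw : TensorProduct.dualDistrib k (A ⧸ I) (A ⧸ I) w = g :=
    (TensorProduct.dualDistribEquiv k (A ⧸ I) (A ⧸ I)).apply_symm_apply g
  let j : Module.Dual k (A ⧸ I) →ₗ[k] I.dualAnnihilator :=
    I.dualQuotEquivDualAnnihilator.toLinearMap
  have hj : ∀ h a, (j h : Module.Dual k A) a = h (I.mkQ a) := fun h a => rfl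
  refine ⟨TensorProduct.map j j w, (TensorProduct.dualDistribEquiv k A A).injective
    (TensorProduct.ext' fun a b => ?_)⟩
  refine Eq.trans ?_ (dualDistrib_dualComul f a b).symm
  rw [← hg, ← hw]
  change TensorProduct.dualDistrib k A A _ _ = _
  generalize w = w
  induction w with
  | zero => simp
  | add z w hz hw => simp only [map_add, LinearMap.add_apply, hz, hw]
  | tmul p q => simp [hj]

/-- If `A*` is pointed, then every simple right `A`-module is at most one-dimensional. -/
theorem exists_injective_of_dualIsPointed (hA : DualIsPointed k A) (M : Type u) [AddCommGroup M]
    [Module k M] [Module Aᵐᵒᵖ M] [IsScalarTower k Aᵐᵒᵖ M] [IsSimpleModule Aᵐᵒᵖ M] :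
    ∃ φ : M →ₗ[k] k, Function.Injective φ := by
  let I : Submodule k A := ((Module.annihilator Aᵐᵒᵖ M).restrictScalars k).comap
    (MulOpposite.opLinearEquiv k : A ≃ₗ[k] Aᵐᵒᵖ).toLinearMap
  have hI : ∀ a, a ∈ I ↔ ∀ m : M, MulOpposite.op a • m = 0 := fun a => Module.mem_annihilator
  have hIl : ∀ a, ∀ b ∈ I, a * b ∈ I := fun a b hb => (hI _).mpr fun m => by
    rw [MulOpposite.op_mul, mul_smul, (hI b).mp hb]
  have hIr : ∀ a ∈ I, ∀ b, a * b ∈ I := fun a ha b => (hI _).mpr fun m => by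
    rw [MulOpposite.op_mul, mul_smul, (hI a).mp ha, smul_zero]
  have hne : I.dualAnnihilator ≠ ⊥ := by
    intro h
    have htop : I = ⊤ := by
      rw [← Subspace.dualAnnihilator_inj, h, Submodule.dualAnnihilator_top]
    obtain ⟨m, hm⟩ := @exists_ne M (IsSimpleModule.nontrivial Aᵐᵒᵖ M) 0
    exact hm (by simpa using (hI 1).mp (htop ▸ Submodule.mem_top) m)
  let := dualCoalgebra k A
  obtain ⟨D, hDE, hD⟩ := exists_simpleSubcoalgebra_le _
    (isSubcoalgebra_dualAnnihilator I hIl hIr) hne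
  obtain ⟨⟨f, hfD⟩, hf0, hspan⟩ := exists_generator_of_finrank_eq_one D (hA D hD)
  have hfI : ∀ x ∈ I, f x = 0 := (Submodule.mem_dualAnnihilator f).mp (hDE hfD)
  -- The coproduct of `f` lies in `D ⊗ D = k (f ⊗ f)`. No normalisation of `f` to a character is
  -- needed.
  obtain ⟨c, hc⟩ : ∃ c : k, ∀ a b, f (a * b) = c * (f a * f b) := by
    obtain ⟨w, hw⟩ := hD.1 f hfD
    have key : ∀ w : D ⊗[k] D, ∃ c : k, ∀ a b, TensorProduct.dualDistrib k A A
        (TensorProduct.map D.subtype D.subtype w) (a ⊗ₜ b) = c * (f a * f b) := by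
      intro w
      induction w with
      | zero => exact ⟨0, by simp⟩
      | add z w hz hw =>
        obtain ⟨c, hc⟩ := hz
        obtain ⟨d, hd⟩ := hw
        exact ⟨c + d, fun a b => by rw [map_add, map_add, LinearMap.add_apply, hc, hd, add_mul]⟩
      | tmul p q =>
        obtain ⟨s, rfl⟩ := hspan p
        obtain ⟨t, rfl⟩ := hspan q
        exact ⟨s * t, fun a b => by simp; ring⟩
    obtain ⟨c, hc⟩ := key w
    refine ⟨c, fun a b => ?_⟩
    rw [← dualDistrib_dualComul, ← hc, hw]
    rfl
  -- By `hc` the kernel of `f` is an ideal; the quotient by it embeds in `k` through `f`, and it is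
  -- killed by the annihilator of `M` because `f` vanishes on `I`.
  let J : Submodule Aᵐᵒᵖ Aᵐᵒᵖ :=
    { carrier := {x | f x.unop = 0}
      add_mem' := fun {x y} hx hy => by
        simp only [Set.mem_ofPred_eq] at hx hy ⊢
        rw [MulOpposite.unop_add, map_add, hx, hy, add_zero]
      zero_mem' := by simp
      smul_mem' := fun s x hx => by
        simp only [Set.mem_ofPred_eq] at hx ⊢
        rw [smul_eq_mul, MulOpposite.unop_mul, hc, hx, zero_mul, mul_zero] }
  have hJ : ∀ x, x ∈ J ↔ f x.unop = 0 := fun x => Iff.rfl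
  have hann : Module.annihilator Aᵐᵒᵖ M ≤ Module.annihilator Aᵐᵒᵖ (Aᵐᵒᵖ ⧸ J) := by
    intro s hs
    refine Module.mem_annihilator.mpr fun q => ?_
    obtain ⟨x, rfl⟩ := J.mkQ_surjective q
    rw [← map_smul, Submodule.mkQ_apply, Submodule.Quotient.mk_eq_zero, hJ, smul_eq_mul,
      MulOpposite.unop_mul, hc, hfI s.unop hs, mul_zero, mul_zero]
  have : Module.Finite k Aᵐᵒᵖ := Module.Finite.equiv (MulOpposite.opLinearEquiv k : A ≃ₗ[k] Aᵐᵒᵖ)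
  have : Module.Finite k M := Module.Finite.trans Aᵐᵒᵖ M
  -- The simple module `M` generates `Aᵐᵒᵖ ⧸ J`, which is nonzero as `f ≠ 0`. Some homomorphism from
  -- `M` is then nonzero, hence injective.
  have hgen := iSup_range_eq_top_of_annihilator_le (S := Aᵐᵒᵖ) (N := M) (M := Aᵐᵒᵖ ⧸ J) k hann
  obtain ⟨g, hg⟩ : ∃ g : M →ₗ[Aᵐᵒᵖ] (Aᵐᵒᵖ ⧸ J), g ≠ 0 := by
    by_contra! hcon
    have hbot : (⊤ : Submodule Aᵐᵒᵖ (Aᵐᵒᵖ ⧸ J)) = ⊥ := by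
      rw [← hgen, iSup_eq_bot]
      intro g
      rw [hcon g, LinearMap.range_zero]
    refine hf0 (Subtype.ext (LinearMap.ext fun a => ?_))
    have ha : J.mkQ (MulOpposite.op a) ∈ (⊤ : Submodule Aᵐᵒᵖ (Aᵐᵒᵖ ⧸ J)) := Submodule.mem_top
    rw [hbot, Submodule.mem_bot, Submodule.mkQ_apply, Submodule.Quotient.mk_eq_zero] at ha
    exact ha
  let fbar : (Aᵐᵒᵖ ⧸ J) →ₗ[k] k := (J.restrictScalars k).liftQ
    (f ∘ₗ (MulOpposite.opLinearEquiv k : A ≃ₗ[k] Aᵐᵒᵖ).symm.toLinearMap) fun x hx => hx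
  have hfbar : Function.Injective fbar := by
    refine (injective_iff_map_eq_zero _).mpr fun q hq => ?_
    obtain ⟨x, rfl⟩ := J.mkQ_surjective q
    exact (Submodule.Quotient.mk_eq_zero J).mpr hq
  have hginj : Function.Injective g := LinearMap.injective_of_ne_zero hg
  exact ⟨fbar ∘ₗ g.restrictScalars k, hfbar.comp hginj⟩

end Pointed

/-- A module of dimension at most one has no submodules besides `⊥` and `⊤`. -/
theorem isSemisimpleModule_of_injective {k : Type*} {S : Type*} [Field k] [Ring S] [Algebra k S]
    {M : Type*} [AddCommGroup M] [Module k M] [Module S M] [IsScalarTower k S M]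
    (φ : M →ₗ[k] k) (hφ : Function.Injective φ) : IsSemisimpleModule S M := by
  have h : ∀ X : Submodule S M, X = ⊥ ∨ X = ⊤ := by
    refine fun X => or_iff_not_imp_left.mpr fun hX => eq_top_iff.mpr fun y _ => ?_
    obtain ⟨x, hxX, hx⟩ := X.ne_bot_iff.mp hX
    have hx' : φ x ≠ 0 := fun h => hx (hφ (h.trans (map_zero φ).symm))
    have : y = (φ y / φ x) • x := hφ (by simp [hx'])
    rw [this]
    exact X.smul_of_tower_mem _ hxX
  have : ComplementedLattice (Submodule S M) := ⟨fun X => by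
    rcases h X with rfl | rfl
    · exact ⟨⊤, isCompl_bot_top⟩
    · exact ⟨⊥, isCompl_top_bot⟩⟩
  exact {}

/-- A finite-dimensional bialgebra with pointed dual has the Chevalley property. -/
theorem chevalleyProperty_of_dualIsPointed {k : Type v} [Field k] {A : Type u} [Ring A]
    [Bialgebra k A] [FiniteDimensional k A] (hA : DualIsPointed k A) : ChevalleyProperty k A := by
  intro M N _ _ _ _ _ _ _ _ hM hN
  obtain ⟨φ, hφ⟩ := exists_injective_of_dualIsPointed hA M
  obtain ⟨ψ, hψ⟩ := exists_injective_of_dualIsPointed hA N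
  refine isSemisimpleModule_of_injective ((TensorProduct.lid k k).toLinearMap ∘ₗ
    TensorProduct.map φ ψ ∘ₗ (rightTensorEquiv k M N).toLinearMap) ?_
  exact (TensorProduct.lid k k).injective.comp
    ((TensorProduct.map_injective_of_flat_flat φ ψ hφ hψ).comp (rightTensorEquiv k M N).injective)

/-! ### Finite depth under each of the three conditions. -/

namespace HopfSubalgebra

variable {k : Type v} {H : Type u} [Field k] [Ring H] [HopfAlgebra k H] [FiniteDimensional k H]
  (R : HopfSubalgebra k H)

/-- Indecomposables are taken over `H`, divisibility over `R`: the inclusion `V^{⊗n} → V^{⊗(n+1)}`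
is only `R`-linear. -/
theorem minDepth_lt_top_of_finiteRepresentationType (hH : FiniteRepresentationType H) :
    minDepth R.toSubalgebra < ⊤ := by
  obtain ⟨n, hn⟩ := KRightMod.exists_summandOfMultiple_of_finiteRepresentationType hH
    R.toSubalgebra.val R.permPow R.summandOfMultiple_permPowRes_succ
  exact R.minDepth_lt_top hn

theorem minDepth_lt_top_of_finiteRepresentationType_carrier
    (hR : FiniteRepresentationType R.Carrier) : minDepth R.toSubalgebra < ⊤ := by
  obtain ⟨n, hn⟩ := KRightMod.exists_summandOfMultiple_of_finiteRepresentationType hR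
    (AlgHom.id k R.Carrier) R.permPowRes R.summandOfMultiple_permPowRes_succ
  exact R.minDepth_lt_top hn

theorem finite_mulOpposite_carrier : Module.Finite k R.Carrierᵐᵒᵖ :=
  Module.Finite.equiv (MulOpposite.opLinearEquiv k : R.Carrier ≃ₗ[k] R.Carrierᵐᵒᵖ)

theorem minDepth_lt_top_of_projective (hV : Module.Projective Hᵐᵒᵖ R.PermModule) :
    minDepth R.toSubalgebra < ⊤ := by
  have : Module.Finite k Hᵐᵒᵖ := Module.Finite.equiv (MulOpposite.opLinearEquiv k : H ≃ₗ[k] Hᵐᵒᵖ)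
  have : IsNoetherianRing Hᵐᵒᵖ := IsNoetherianRing.of_finite k Hᵐᵒᵖ
  have hfin : ∀ n, Module.Finite Hᵐᵒᵖ (R.permPow n).carrier := fun n =>
    Module.Finite.of_restrictScalars_finite k Hᵐᵒᵖ _
  have : Module.Projective Hᵐᵒᵖ R.permMod.carrier := hV
  have : Module.Finite Hᵐᵒᵖ R.permMod.carrier := hfin 0
  have hmod : SummandOfMultiple Hᵐᵒᵖ R.permMod.carrier Hᵐᵒᵖ := summandOfMultiple_self_of_projective
  have hpow : ∀ n, SummandOfMultiple Hᵐᵒᵖ (R.permPow n).carrier Hᵐᵒᵖ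
    | 0 => hmod
    | n + 1 => KRightMod.summandOfMultiple_tensor_self (R.permPow n) R.permMod hmod
  obtain ⟨n, hn⟩ := exists_summandOfMultiple_of_projective (fun n => (R.permPow n).carrier) hpow
    R.permPowProj R.permPowProj_surjective
  -- The tower argument runs over `H`, where the projections are linear; only its outcome is
  -- restricted to `R`.
  exact R.minDepth_lt_top (KRightMod.summandOfMultiple_restrict R.toSubalgebra.val hn)

theorem minDepth_lt_top_of_projective_carrier (hV : Module.Projective R.Carrierᵐᵒᵖ R.PermModule) :
    minDepth R.toSubalgebra < ⊤ := by
  have := R.finite_mulOpposite_carrier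
  have : IsNoetherianRing R.Carrierᵐᵒᵖ := IsNoetherianRing.of_finite k R.Carrierᵐᵒᵖ
  have hfin : ∀ n, Module.Finite R.Carrierᵐᵒᵖ (R.permPowRes n).carrier := fun n =>
    Module.Finite.of_restrictScalars_finite k R.Carrierᵐᵒᵖ _
  have : Module.Projective R.Carrierᵐᵒᵖ (R.permPowRes 0).carrier := hV
  have hmod : SummandOfMultiple R.Carrierᵐᵒᵖ (R.permPowRes 0).carrier R.Carrierᵐᵒᵖ :=
    summandOfMultiple_self_of_projective
  have hpow : ∀ n, SummandOfMultiple R.Carrierᵐᵒᵖ (R.permPowRes n).carrier R.Carrierᵐᵒᵖ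
    | 0 => hmod
    -- Restriction to `R` commutes with tensor products, so projectivity of `V` over the Hopf
    -- algebra `R` passes to the next power.
    | n + 1 => (SummandOfMultiple.of_equiv (KRightMod.restrictTensor R.toSubalgebra.val
        R.comul_val (R.permPow n) R.permMod).symm).trans
          (KRightMod.summandOfMultiple_tensor_self (R.permPowRes n) (R.permPowRes 0) hmod)
  obtain ⟨n, hn⟩ := exists_summandOfMultiple_of_projective (fun n => (R.permPowRes n).carrier) hpow
    (fun n => KRightMod.restrictMap R.toSubalgebra.val (R.permPowProj n)) R.permPowProj_surjective
  exact R.minDepth_lt_top hn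

theorem minDepth_lt_top_of_isSemisimpleModule
    (hV : IsSemisimpleModule R.Carrierᵐᵒᵖ R.PermModule) (hR : ChevalleyProperty k R.Carrier) :
    minDepth R.toSubalgebra < ⊤ := by
  have := R.finite_mulOpposite_carrier
  have : IsArtinianRing R.Carrierᵐᵒᵖ := IsArtinianRing.of_finite k R.Carrierᵐᵒᵖ
  have hpow : ∀ n, IsSemisimpleModule R.Carrierᵐᵒᵖ (R.permPowRes n).carrier := by
    intro n
    induction n with
    | zero => exact hV
    | succ n ih =>
      have := KRightMod.isSemisimpleModule_tensor hR (R.permPowRes n) (R.permPowRes 0) ih hV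
      exact (KRightMod.restrictTensor R.toSubalgebra.val R.comul_val (R.permPow n)
        R.permMod).isSemisimpleModule_iff.mp this
  obtain ⟨n, hn⟩ := exists_summandOfMultiple_of_isSemisimpleModule k
    (fun n => (R.permPowRes n).carrier) hpow
    (fun n => KRightMod.restrictMap R.toSubalgebra.val (R.permPowProj n)) R.permPowProj_surjective
  exact R.minDepth_lt_top hn

end HopfSubalgebra

end HopfDepth

end

theorem mainTheorem3 {k : Type v} {H : Type u} [Field k] [Ring H] [HopfAlgebra k H]
    [FiniteDimensional k H] (R : HopfDepth.HopfSubalgebra k H) :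
    -- (1) `R` or `H` has finite representation type
    (HopfDepth.FiniteRepresentationType R.Carrier ∨ HopfDepth.FiniteRepresentationType H →
      HopfDepth.minDepth R.toSubalgebra < ⊤) ∧
    -- (2) `V` is projective, as an `R`-module or as an `H`-module
    (Module.Projective R.Carrierᵐᵒᵖ R.PermModule ∨ Module.Projective Hᵐᵒᵖ R.PermModule →
      HopfDepth.minDepth R.toSubalgebra < ⊤) ∧
    -- (3) `V` is a semisimple `R`-module and `R` has the Chevalley property
    (IsSemisimpleModule R.Carrierᵐᵒᵖ R.PermModule ∧ HopfDepth.ChevalleyProperty k R.Carrier →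
      HopfDepth.minDepth R.toSubalgebra < ⊤) ∧
    -- `R` has the Chevalley property if `R*` is pointed
    (HopfDepth.DualIsPointed k R.Carrier → HopfDepth.ChevalleyProperty k R.Carrier) :=
  ⟨fun h => h.elim R.minDepth_lt_top_of_finiteRepresentationType_carrier
      R.minDepth_lt_top_of_finiteRepresentationType,
    fun h => h.elim R.minDepth_lt_top_of_projective_carrier R.minDepth_lt_top_of_projective,
    fun h => R.minDepth_lt_top_of_isSemisimpleModule h.1 h.2,
    HopfDepth.chevalleyProperty_of_dualIsPointed⟩
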